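/- Let $X$ be a real Banach space with dual $X^*$. A set $D\subseteq X^*$ is \emph{norming} if there is $r>0$ with $\|x\|\le r\sup\{|\varphi(x)|/\|\varphi\| : \varphi\in D\setminus\{0\}\}$ for all $x\in X$. For a cardinal $\theta$ let $H(\theta)$ be the set of all sets whose transitive closure has cardinality less than $\theta$. A norming set $D\subseteq X^*$ \emph{generates projections in $X$} if there is a cardinal $\theta_0$ such that for every regular cardinal $\theta\ge\theta_0$ and every countable elementary substructure $M$ of $(H(\theta),\in)$ with $X, D\in M$ one has $$X=\operatorname{cl}(X\cap M)\oplus{}^{\perp}(D\cap M),$$ where $\operatorname{cl}$ is the norm closure and ${}^{\perp}B=\{x\in X : b(x)=0 \text{ for all } b\in B\}$. (Here $X\in M$ refers to $X$ as a normed space, i.e. its underlying set, operations, norm and field of scalars belong to $M$; $X$ and $\mathbb{R}$ may be represented by any sets of the appropriate cardinality, with the transported structure.) A pair $(X,D)$, with $D\subseteq X^*$ a norming linear subspace, is a \emph{Plichko pair} if there is a set $A\subseteq X$ with dense linear span such that $\{a\in A : y(a)\ne0\}$ is countable for every $y\in D$; and $X$ is \emph{weakly Lindelöf determined} (WLD)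 if $(X,X^*)$ is a Plichko pair. For every real Banach space $X$ the following properties are equivalent: (a) $X^*$ generates projections in $X$. (b) $X$ is weakly Lindelöf determined. -/

import Mathlib

universe u

/-! ### The structures `(H(θ), ∈)` and their elementary substructures -/

/-- The only non-logical symbol of the language of set theory. -/
inductive SetSymbol : ℕ → Type
  | mem : SetSymbol 2

/-- The first-order language of set theory, with the single binary relation symbol `∈`. -/
def setLanguage : FirstOrder.Language := ⟨fun _ => Empty, SetSymbol⟩

/-- The transitive closure of the set `x`: all `y` with `y ∈ x₀ ∈ ⋯ ∈ x`. -/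
def transClosure (x : ZFSet.{u}) : Set ZFSet.{u} :=
  {y | Relation.TransGen (fun a b : ZFSet.{u} => a ∈ b) y x}

/-- `H(θ)`: all sets whose transitive closure has cardinality less than `θ`. -/
def HSet (θ : Cardinal.{u}) : Type (u + 1) :=
  {x : ZFSet.{u} // Cardinal.mk (transClosure x) < Cardinal.lift.{u + 1} θ}

/-- `H(θ)` as a structure for the language of set theory, with the true membership relation. -/
instance HSet.instStructure (θ : Cardinal.{u}) : setLanguage.Structure (HSet θ) where
  funMap f := f.elim
  RelMap
    | .mem => fun v => (v 0).1 ∈ (v 1).1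

/-- The elements of an elementary substructure of `H(θ)`, as a set of sets. -/
def elements {θ : Cardinal.{u}} (M : setLanguage.ElementarySubstructure (HSet θ)) :
    Set ZFSet.{u} :=
  {z | ∃ y ∈ M, y.1 = z}

/-! ### Normed spaces as sets -/

/-- A copy of the normed space `X` and of the real line in the universe of sets: every point of `X`
and every real number is represented by a set, different points by different sets. -/
structure SetCopy (X : Type u) where
  pt : X ↪ ZFSet.{u}
  real : ℝ ↪ ZFSet.{u}

/-- Every type has a copy in the universe of sets. -/
theorem SetCopy.nonempty (X : Type u) : Nonempty (SetCopy X) := by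
  have key : ∀ Y : Type u, Nonempty (Y ↪ ZFSet.{u}) := fun Y =>
    ⟨⟨fun y => (Ordinal.typein (WellOrderingRel (α := Y)) y).toZFSet, fun a b h =>
      Ordinal.typein_injective _ (Ordinal.toZFSet_injective h)⟩⟩
  obtain ⟨f⟩ := key X
  obtain ⟨g⟩ := key (ULift.{u} ℝ)
  exact ⟨⟨f, Equiv.ulift.symm.toEmbedding.trans g⟩⟩

namespace SetCopy

variable {X : Type u} [NormedAddCommGroup X] [NormedSpace ℝ X] (c : SetCopy X)

/-- The underlying set of `X`. -/
noncomputable def carrier : ZFSet.{u} := ZFSet.range c.pt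

/-- The set of real numbers. -/
noncomputable def reals : ZFSet.{u} := ZFSet.range c.real

/-- The graph of the addition `X × X → X`. -/
noncomputable def add : ZFSet.{u} :=
  ZFSet.range fun p : X × X => ZFSet.pair (ZFSet.pair (c.pt p.1) (c.pt p.2)) (c.pt (p.1 + p.2))

/-- The graph of the scalar multiplication `ℝ × X → X`. -/
noncomputable def smul : ZFSet.{u} :=
  ZFSet.range fun p : ℝ × X => ZFSet.pair (ZFSet.pair (c.real p.1) (c.pt p.2)) (c.pt (p.1 • p.2))

/-- The graph of the norm `X → ℝ`. -/
noncomputable def norm : ZFSet.{u} :=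
  ZFSet.range fun x : X => ZFSet.pair (c.pt x) (c.real ‖x‖)

/-- The graph of the addition of real numbers. -/
noncomputable def realAdd : ZFSet.{u} :=
  ZFSet.range fun p : ℝ × ℝ =>
    ZFSet.pair (ZFSet.pair (c.real p.1) (c.real p.2)) (c.real (p.1 + p.2))

/-- The graph of the multiplication of real numbers. -/
noncomputable def realMul : ZFSet.{u} :=
  ZFSet.range fun p : ℝ × ℝ =>
    ZFSet.pair (ZFSet.pair (c.real p.1) (c.real p.2)) (c.real (p.1 * p.2))

/-- The order relation of the real numbers. -/
noncomputable def realLE : ZFSet.{u} :=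
  ZFSet.range fun p : {p : ℝ × ℝ // p.1 ≤ p.2} => ZFSet.pair (c.real p.1.1) (c.real p.1.2)

/-- A continuous linear functional as a set, namely its graph. -/
noncomputable def functional (φ : StrongDual ℝ X) : ZFSet.{u} :=
  ZFSet.range fun x : X => ZFSet.pair (c.pt x) (c.real (φ x))

/-- A set of continuous linear functionals as a set of graphs. -/
noncomputable def functionals (D : Set (StrongDual ℝ X)) : ZFSet.{u} :=
  ZFSet.range fun φ : D => c.functional φ.1

/-- The components of the normed space `X`, together with those of its field of scalars. An
elementary substructure of `H(θ)`, `θ` regular and uncountable, contains a finite tuple of sets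
exactly when it contains all entries; so "`X ∈ M`" means that `M` contains all these sets. -/
def components : Set ZFSet.{u} :=
  {c.carrier, c.add, c.smul, c.norm, c.reals, c.realAdd, c.realMul, c.realLE}

end SetCopy

section BanachSpaces

variable {X : Type u} [NormedAddCommGroup X] [NormedSpace ℝ X]

/-- `D ⊆ X*` is norming: `|x| = sup {|φ x| / ‖φ‖ : φ ∈ D \ {0}}` is an equivalent norm on `X`, that
is, `‖x‖ ≤ r |x|` for some constant `r` (and `|x| ≤ ‖x‖` always holds, so the supremum is over a
bounded set). -/
def IsNorming (D : Set (StrongDual ℝ X)) : Prop :=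
  ∃ r : ℝ, 0 < r ∧ ∀ x : X, ‖x‖ ≤ r * sSup {t : ℝ | ∃ φ ∈ D, φ ≠ 0 ∧ t = |φ x| / ‖φ‖}

/-- The left annihilator `{x ∈ X : b(x) = 0 for all b ∈ B}` of `B ⊆ X*`. -/
def leftAnnihilator (B : Set (StrongDual ℝ X)) : Submodule ℝ X where
  carrier := {x | ∀ b ∈ B, b x = 0}
  add_mem' hx hy b hb := by simp [hx b hb, hy b hb]
  zero_mem' b _ := by simp
  smul_mem' r x hx b hb := by simp [hx b hb]

/-- `X = X_M ⊕ ⊥(D ∩ M)`, where `X_M` is the norm closure of `X ∩ M`: the set `X_M` is a linear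
subspace of `X`, and it is a complement of the (closed) subspace `⊥(D ∩ M)`. -/
def SetCopy.Decomposes (c : SetCopy X) (D : Set (StrongDual ℝ X)) (M : Set ZFSet.{u}) : Prop :=
  ∃ Y : Submodule ℝ X, (Y : Set X) = closure {x | c.pt x ∈ M} ∧
    IsCompl Y (leftAnnihilator {φ | φ ∈ D ∧ c.functional φ ∈ M})

/-- The norming set `D ⊆ X*` generates projections in `X`: for all big enough regular cardinals `θ`
and all countable elementary substructures `M` of `(H(θ), ∈)` with `X, D ∈ M`,
one has `X = X_M ⊕ ⊥(D ∩ M)`. -/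
def SetCopy.GeneratesProjections (c : SetCopy X) (D : Set (StrongDual ℝ X)) : Prop :=
  IsNorming D ∧
    ∃ θ₀ : Cardinal.{u}, ∀ θ : Cardinal.{u}, θ₀ ≤ θ → θ.IsRegular →
      ∀ M : setLanguage.ElementarySubstructure (HSet θ), (elements M).Countable →
        c.components ⊆ elements M → c.functionals D ∈ elements M →
          c.Decomposes D (elements M)

/-- `(X, D)` is a Plichko pair: `D` is a norming linear subspace of `X*`, and there is a linearly
dense set `A ⊆ X` such that `{a ∈ A : y(a) ≠ 0}` is countable for every `y ∈ D`. -/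
def IsPlichkoPair (D : Submodule ℝ (StrongDual ℝ X)) : Prop :=
  IsNorming (D : Set (StrongDual ℝ X)) ∧
    ∃ A : Set X, Dense (Submodule.span ℝ A : Set X) ∧
      ∀ y ∈ D, {a | a ∈ A ∧ y a ≠ 0}.Countable

variable (X) in
/-- `X` is weakly Lindelöf determined: `(X, X*)` is a Plichko pair. -/
def IsWLD : Prop := IsPlichkoPair (⊤ : Submodule ℝ (StrongDual ℝ X))

end BanachSpaces

open FirstOrder Language

set_option linter.unusedSectionVars false

/-! From (b) to (a): let `M` be an elementary submodel as in (a). With each of its points `x` it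
contains a functional of norm at most one with value `‖x‖` at `x`, so `‖x‖ ≤ ‖x + z‖` for `x` in
`cl(X ∩ M)` and `z` in `⊥(X* ∩ M)`. The two subspaces therefore meet in `0` and have a closed sum,
and by Hahn-Banach the sum is `X` once no nonzero functional vanishes on both. Elementarity gives a
Plichko set `A ∈ M`. The support on `A` of a functional in `M` has an enumeration in `M`, so it lies
inside `M`; hence every point of `A` outside `M` belongs to `⊥(X* ∩ M)`. A functional vanishing on
both summands vanishes on `A`, so it is zero (`SetCopy.InHSet.Mem.decomposes`).

From (a) to (b): fix one large regular `θ` and take Skolem hulls in `H(θ)`. Hulls of countable sets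
of points and functionals give projections of norm at most one, and a limit argument extends this to
hulls of arbitrary sets (`ProjectionHull.exists_isProj`). Along a well-ordered enumeration these
hulls form a continuous increasing chain. Every functional distinguishes only countably many pairs
of consecutive projections (`ProjectionHull.countable_setOf_apply_proj_ne`). The proof of this puts
compositions of the functional with projections into a hull, which is possible because the whole of
`X*` generates projections. A Plichko set is then assembled from the differences of consecutive
projections, by induction on the cardinality of the generating set
(`ProjectionHull.HasPlichkoSet.range`, `ProjectionHull.hasPlichkoSet`). -/

/-! ### First-order definable predicates -/

/-- The predicate `P` on tuples is defined by a first-order formula without parameters. -/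
def FODefinable (L : Language) {H : Type*} [L.Structure H] {α : Type} (P : (α → H) → Prop) : Prop :=
  ∃ φ : L.Formula α, ∀ v, φ.Realize v ↔ P v

namespace FODefinable

variable {L : Language} {H : Type*} [L.Structure H] {α : Type} {P Q : (α → H) → Prop}

theorem not (hP : FODefinable L P) : FODefinable L fun v => ¬ P v := by
  obtain ⟨φ, hφ⟩ := hP
  exact ⟨φ.not, fun v => by simp [Formula.realize_not, hφ]⟩

theorem and (hP : FODefinable L P) (hQ : FODefinable L Q) : FODefinable L fun v => P v ∧ Q v := by
  obtain ⟨φ, hφ⟩ := hP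
  obtain ⟨ψ, hψ⟩ := hQ
  exact ⟨φ ⊓ ψ, fun v => by simp [Formula.realize_inf, hφ, hψ]⟩

theorem congr (hP : FODefinable L P) (h : ∀ v, Q v ↔ P v) : FODefinable L Q := by
  obtain ⟨φ, hφ⟩ := hP
  exact ⟨φ, fun v => by rw [hφ, h]⟩

theorem or (hP : FODefinable L P) (hQ : FODefinable L Q) : FODefinable L fun v => P v ∨ Q v :=
  (hP.not.and hQ.not).not.congr fun v => by tauto

theorem imp (hP : FODefinable L P) (hQ : FODefinable L Q) : FODefinable L fun v => P v → Q v :=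
  (hP.and hQ.not).not.congr fun v => by tauto

theorem iff (hP : FODefinable L P) (hQ : FODefinable L Q) : FODefinable L fun v => (P v ↔ Q v) :=
  ((hP.imp hQ).and (hQ.imp hP)).congr fun v => by tauto

/-- The bound variable becomes the extra coordinate `Unit`, so nested quantifiers are handled by
unification instead of by explicit formulas. -/
theorem ex {R : (α → H) → H → Prop}
    (hR : FODefinable L fun w : α ⊕ Unit → H => R (fun a => w (.inl a)) (w (.inr ()))) :
    FODefinable L fun v => ∃ x, R v x := by
  obtain ⟨φ, hφ⟩ := hR
  refine ⟨φ.iExs Unit, fun v => ?_⟩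
  rw [Formula.realize_iExs]
  simp only [hφ, Sum.elim_inl, Sum.elim_inr]
  exact ⟨fun ⟨i, hi⟩ => ⟨_, hi⟩, fun ⟨x, hx⟩ => ⟨fun _ => x, hx⟩⟩

theorem all {R : (α → H) → H → Prop}
    (hR : FODefinable L fun w : α ⊕ Unit → H => R (fun a => w (.inl a)) (w (.inr ()))) :
    FODefinable L fun v => ∀ x, R v x :=
  (FODefinable.ex (R := fun v x => ¬ R v x) hR.not).not.congr fun v => by simp

theorem eq (a b : α) : FODefinable L fun v : α → H => v a = v b :=
  ⟨Term.equal (Term.var a) (Term.var b), fun v => by simp [Formula.realize_equal]⟩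

end FODefinable

/-- An elementary substructure contains a witness for every definable property, with parameters in
the substructure, of some element of the structure. -/
theorem FirstOrder.Language.ElementarySubstructure.exists_mem_of_foDefinable {L : Language}
    {H : Type*} [L.Structure H] (M : L.ElementarySubstructure H) {α : Type}
    {R : (α → H) → H → Prop}
    (hR : FODefinable L fun w : α ⊕ Unit → H => R (fun a => w (.inl a)) (w (.inr ())))
    (v : α → H) (hv : ∀ a, v a ∈ M) (h : ∃ x, R v x) : ∃ x ∈ M, R v x := by
  obtain ⟨φ, hφ⟩ := hR
  have h1 : (φ.iExs Unit).Realize (M.subtype ∘ fun a => (⟨v a, hv a⟩ : M)) := by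
    rw [Formula.realize_iExs]
    obtain ⟨x, hx⟩ := h
    exact ⟨fun _ => x, by rw [hφ]; exact hx⟩
  rw [ElementaryEmbedding.map_formula, Formula.realize_iExs] at h1
  obtain ⟨i, hi⟩ := h1
  rw [← ElementaryEmbedding.map_formula M.subtype, hφ] at hi
  exact ⟨i (), (i ()).2, hi⟩

/-! ### Transitive closures and the sets `H(θ)` -/

theorem transClosure_subset_of_mem {x y : ZFSet.{u}} (h : y ∈ x) :
    transClosure y ⊆ transClosure x :=
  fun _ hz => Relation.TransGen.tail hz h

theorem transClosure_subset_of_subset {x y : ZFSet.{u}} (h : y ⊆ x) :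
    transClosure y ⊆ transClosure x := by
  intro z hz
  obtain ⟨w, hw, h1⟩ := Relation.TransGen.tail'_iff.1 hz
  exact Relation.TransGen.tail' hw (h h1)

/-- Rank decreases strictly along membership, so everything below `x` lies in the level of the von
Neumann hierarchy at the rank of `x`, which is a set. -/
theorem transClosure_small (x : ZFSet.{u}) : Small.{u} (transClosure x) := by
  have h : transClosure x ⊆ {y | y ∈ (ZFSet.vonNeumann (ZFSet.rank x) : ZFSet.{u})} := by
    intro y hy
    have : ∀ z, Relation.TransGen (fun a b : ZFSet.{u} => a ∈ b) y z →
        ZFSet.rank y < ZFSet.rank z := by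
      intro z hz
      induction hz with
      | single h => exact ZFSet.rank_lt_of_mem h
      | tail _ h ih => exact ih.trans (ZFSet.rank_lt_of_mem h)
    exact ZFSet.mem_vonNeumann.2 (this x hy)
  have h1 : Small.{u} {y | y ∈ (ZFSet.vonNeumann (ZFSet.rank x) : ZFSet.{u})} :=
    ZFSet.small_coe _
  exact small_subset h

/-- Every set belongs to `H(θ)` for all sufficiently large `θ`. -/
theorem exists_forall_mem_HSet (x : ZFSet.{u}) : ∃ θ₀ : Cardinal.{u}, ∀ θ, θ₀ ≤ θ →
    Cardinal.mk (transClosure x) < Cardinal.lift.{u + 1} θ := by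
  have := transClosure_small x
  refine ⟨Order.succ (Cardinal.mk (Shrink.{u} (transClosure x))), fun θ hθ => ?_⟩
  have h1 : Cardinal.mk (transClosure x) =
      Cardinal.lift.{u + 1} (Cardinal.mk (Shrink.{u} (transClosure x))) := by
    have := Cardinal.lift_mk_eq'.2 ⟨equivShrink.{u} (transClosure x)⟩
    rw [← Cardinal.lift_umax.{u, u + 1}, ← this, Cardinal.lift_id'.{u, u+1}]
  rw [h1, Cardinal.lift_lt]
  exact (Order.lt_succ _).trans_le hθ

namespace HSet

variable {θ : Cardinal.{u}}

/-- `H(θ)` is transitive. -/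
def ofMem (x : HSet θ) {y : ZFSet.{u}} (h : y ∈ x.1) : HSet θ :=
  ⟨y, (Cardinal.mk_le_mk_of_subset (transClosure_subset_of_mem h)).trans_lt x.2⟩

/-- `H(θ)` is closed under subsets. -/
def ofSubset (x : HSet θ) {y : ZFSet.{u}} (h : y ⊆ x.1) : HSet θ :=
  ⟨y, (Cardinal.mk_le_mk_of_subset (transClosure_subset_of_subset h)).trans_lt x.2⟩

theorem ext_iff {x y : HSet θ} : x = y ↔ x.1 = y.1 := Subtype.ext_iff

variable {α : Type}

theorem foDefinable_mem (a b : α) :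
    FODefinable setLanguage fun v : α → HSet θ => (v a).1 ∈ (v b).1 := by
  refine ⟨Relations.formula₂ (L := setLanguage) SetSymbol.mem (Term.var a) (Term.var b),
    fun v => ?_⟩
  exact Formula.realize_rel₂

theorem eq_insert_iff (z a b : HSet θ) :
    z.1 = {a.1, b.1} ↔ ∀ w : HSet θ, w.1 ∈ z.1 ↔ w = a ∨ w = b := by
  constructor
  · intro h w
    rw [h, ZFSet.mem_pair, ext_iff, ext_iff]
  · intro h
    ext w
    rw [ZFSet.mem_pair]
    constructor
    · intro hw
      have := (h (z.ofMem hw)).1 hw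
      rwa [ext_iff, ext_iff] at this
    · rintro (rfl | rfl)
      · exact (h a).2 (.inl rfl)
      · exact (h b).2 (.inr rfl)

theorem foDefinable_eq_insert (z a b : α) :
    FODefinable setLanguage fun v : α → HSet θ => (v z).1 = {(v a).1, (v b).1} := by
  refine FODefinable.congr (FODefinable.all ?_) fun v => eq_insert_iff _ _ _
  exact (foDefinable_mem _ _).iff ((FODefinable.eq _ _).or (FODefinable.eq _ _))

/-- The sets `{a}` and `{a, b}` are elements of the pair, so they lie in `H(θ)` by transitivity.
Writing `{a, a}` lets one formula serve for both. -/
theorem eq_pair_iff (p a b : HSet θ) :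
    p.1 = ZFSet.pair a.1 b.1 ↔ ∃ y : HSet θ, ∃ z : HSet θ,
      y.1 = {a.1, a.1} ∧ z.1 = {a.1, b.1} ∧ p.1 = {y.1, z.1} := by
  constructor
  · intro h
    have h1 : ({a.1} : ZFSet) ∈ p.1 := by rw [h]; simp [ZFSet.pair]
    have h2 : ({a.1, b.1} : ZFSet) ∈ p.1 := by rw [h]; simp [ZFSet.pair]
    refine ⟨p.ofMem h1, p.ofMem h2, ?_, rfl, h⟩
    simp [ofMem]
  · rintro ⟨y, z, hy, hz, hp⟩
    rw [hp, hy, hz]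
    simp [ZFSet.pair]

theorem foDefinable_eq_pair (p a b : α) :
    FODefinable setLanguage fun v : α → HSet θ => (v p).1 = ZFSet.pair (v a).1 (v b).1 := by
  refine FODefinable.congr (FODefinable.ex (FODefinable.ex ?_)) fun v => eq_pair_iff _ _ _
  exact (foDefinable_eq_insert _ _ _).and
    ((foDefinable_eq_insert _ _ _).and (foDefinable_eq_insert _ _ _))

/-- A pair that belongs to an element of `H(θ)` is itself in `H(θ)`, so closure of `H(θ)` under
pairing is not needed. -/
theorem foDefinable_pair_mem (a b r : α) :
    FODefinable setLanguage fun v : α → HSet θ => ZFSet.pair (v a).1 (v b).1 ∈ (v r).1 := by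
  refine FODefinable.congr (Q := _)
    (P := fun v : α → HSet θ => ∃ p : HSet θ, p.1 = ZFSet.pair (v a).1 (v b).1 ∧ p.1 ∈ (v r).1)
    (FODefinable.ex ((foDefinable_eq_pair _ _ _).and (foDefinable_mem _ _))) fun v => ?_
  exact ⟨fun h => ⟨(v r).ofMem h, rfl, h⟩, fun ⟨p, hp, h⟩ => hp ▸ h⟩

theorem foDefinable_triple_mem (a b c r : α) :
    FODefinable setLanguage fun v : α → HSet θ =>
      ZFSet.pair (ZFSet.pair (v a).1 (v b).1) (v c).1 ∈ (v r).1 := by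
  refine FODefinable.congr (Q := _)
    (P := fun v : α → HSet θ => ∃ p : HSet θ, p.1 = ZFSet.pair (v a).1 (v b).1 ∧
      ZFSet.pair p.1 (v c).1 ∈ (v r).1)
    (FODefinable.ex ((foDefinable_eq_pair _ _ _).and (foDefinable_pair_mem _ _ _))) fun v => ?_
  constructor
  · intro h
    have h1 : ({ZFSet.pair (v a).1 (v b).1} : ZFSet) ∈ ((v r).ofMem h).1 := by
      simp [ofMem, ZFSet.pair]
    exact ⟨(((v r).ofMem h).ofMem h1).ofMem (ZFSet.mem_singleton.2 rfl), rfl, h⟩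
  · rintro ⟨p, hp, h⟩
    rwa [hp] at h

end HSet

section BanachSpaces

variable {X : Type u} [NormedAddCommGroup X] [NormedSpace ℝ X]

/-! ### Preliminaries on normed spaces -/

theorem exists_dual_eq_zero_of_notMem {p : Submodule ℝ X} (hp : IsClosed (p : Set X)) {x : X}
    (hx : x ∉ p) : ∃ φ : StrongDual ℝ X, (∀ a ∈ p, φ a = 0) ∧ φ x ≠ 0 := by
  obtain ⟨φ, u, h1, h2⟩ := geometric_hahn_banach_closed_point (p.convex) hp hx
  have h0 : 0 < u := by simpa using h1 0 p.zero_mem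
  refine ⟨φ, fun a ha => ?_, (h0.trans h2).ne'⟩
  -- A multiple of `a` would attain the value `u`, which strictly bounds `φ` on the subspace.
  by_contra hne
  have := h1 _ (p.smul_mem (u / φ a) ha)
  rw [map_smul, smul_eq_mul, div_mul_cancel₀ _ hne] at this
  exact lt_irrefl _ this

/-- The closure of a set which contains `0` and is closed under subtraction and halving is a linear
subspace. -/
theorem exists_submodule_coe_eq_closure {S : Set X} (h0 : (0 : X) ∈ S)
    (hsub : ∀ x ∈ S, ∀ y ∈ S, x - y ∈ S) (hhalf : ∀ x ∈ S, (2⁻¹ : ℝ) • x ∈ S) :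
    ∃ Y : Submodule ℝ X, (Y : Set X) = closure S := by
  let G : AddSubgroup X := AddSubgroup.ofSub S ⟨0, h0⟩ fun x hx y hy => by
    simpa [sub_eq_add_neg] using hsub x hx y hy
  have hG : ((G.topologicalClosure : AddSubgroup X) : Set X) = closure S := rfl
  -- The scalars preserving the closed subgroup form a closed subgroup of `ℝ`; it contains all
  -- powers of `1/2`, so it is dense and equals `ℝ`.
  let T : AddSubgroup ℝ :=
    { carrier := {t | ∀ x ∈ G.topologicalClosure, t • x ∈ G.topologicalClosure}
      add_mem' := fun hs ht x hx => by
        rw [add_smul]; exact add_mem (hs x hx) (ht x hx)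
      zero_mem' := fun x _ => by rw [zero_smul]; exact zero_mem _
      neg_mem' := fun ht x hx => by rw [neg_smul]; exact neg_mem (ht x hx) }
  have hTc : IsClosed (T : Set ℝ) := by
    have : (T : Set ℝ) = ⋂ x ∈ G.topologicalClosure,
        (fun t : ℝ => t • x) ⁻¹' (G.topologicalClosure : Set X) := by
      ext t
      simp only [T, Set.mem_iInter]
      rfl
    rw [this]
    exact isClosed_biInter fun x _ =>
      G.isClosed_topologicalClosure.preimage (continuous_id.smul continuous_const)
  have hhalf' : ∀ x ∈ G.topologicalClosure, (2⁻¹ : ℝ) • x ∈ G.topologicalClosure := by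
    intro x hx
    exact map_mem_closure (f := fun x : X => (2⁻¹ : ℝ) • x) (continuous_const_smul _) hx hhalf
  have hpow : ∀ n : ℕ, ((2⁻¹ : ℝ) ^ n) ∈ T := by
    intro n
    induction n with
    | zero => intro x hx; simpa using hx
    | succ n ih => intro x hx; rw [pow_succ, mul_smul]; exact ih _ (hhalf' x hx)
  have hTd : Dense (T : Set ℝ) := by
    refine AddSubgroup.dense_of_not_isolated_zero T fun ε hε => ?_
    obtain ⟨n, hn⟩ := exists_pow_lt_of_lt_one hε (show (2⁻¹ : ℝ) < 1 by norm_num)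
    exact ⟨_, hpow n, by positivity, hn⟩
  have hT : ∀ t : ℝ, t ∈ T := fun t => by
    have := hTd t
    rwa [hTc.closure_eq] at this
  exact ⟨{ G.topologicalClosure with smul_mem' := fun t x hx => hT t x hx }, hG⟩

/-- Two closed subspaces form a topological direct sum if the projection along the second one
has norm one on their sum and no functional except `0` vanishes on both. -/
theorem isCompl_of_norm_le_norm_add [CompleteSpace X] {Y Z : Submodule ℝ X}
    (hY : IsClosed (Y : Set X)) (hZ : IsClosed (Z : Set X))
    (hn : ∀ y ∈ Y, ∀ z ∈ Z, ‖y‖ ≤ ‖y + z‖)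
    (hd : ∀ φ : StrongDual ℝ X, (∀ y ∈ Y, φ y = 0) → (∀ z ∈ Z, φ z = 0) → φ = 0) :
    IsCompl Y Z := by
  have hYc : CompleteSpace Y := hY.completeSpace_coe
  have hZc : CompleteSpace Z := hZ.completeSpace_coe
  let f : Y × Z →L[ℝ] X := Y.subtypeL.coprod Z.subtypeL
  have hf : ∀ p : Y × Z, f p = (p.1 : X) + p.2 := fun p => by simp [f]
  -- The norm inequality bounds the addition map `Y × Z → X` from below, since `‖z‖ ≤ ‖y + z‖ + ‖y‖
  -- ≤ 2‖y + z‖`; so its range is closed.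
  have hanti : AntilipschitzWith 2 f := by
    refine ContinuousLinearMap.antilipschitz_of_bound f fun p => ?_
    rw [hf]
    have h1 := hn p.1 p.1.2 p.2 p.2.2
    have h2 : ‖(p.2 : X)‖ ≤ ‖(p.1 : X) + p.2‖ + ‖(p.1 : X)‖ := by
      simpa using norm_sub_le ((p.1 : X) + p.2) (p.1 : X)
    have h3 : ((2 : NNReal) : ℝ) = 2 := rfl
    rw [Prod.norm_def, h3]
    simp only [Submodule.coe_norm]
    exact max_le (by linarith [norm_nonneg ((p.1 : X) + p.2)]) (by linarith)
  have hr : Set.range f = ((Y ⊔ Z : Submodule ℝ X) : Set X) := by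
    ext x
    simp only [Set.mem_range, SetLike.mem_coe, Submodule.mem_sup, hf]
    exact ⟨fun ⟨p, hp⟩ => ⟨p.1, p.1.2, p.2, p.2.2, hp⟩,
      fun ⟨y, hy, z, hz, h⟩ => ⟨(⟨y, hy⟩, ⟨z, hz⟩), h⟩⟩
  have hcl : IsClosed ((Y ⊔ Z : Submodule ℝ X) : Set X) := by
    rw [← hr]
    exact hanti.isClosed_range f.uniformContinuous
  refine ⟨Submodule.disjoint_def.2 fun x hx hx' => ?_, codisjoint_iff.2 ?_⟩
  · have := hn x hx (-x) (Z.neg_mem hx')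
    simpa using this
  · by_contra hne
    obtain ⟨x, hx⟩ : ∃ x, x ∉ Y ⊔ Z := by
      by_contra! h
      exact hne (eq_top_iff.2 fun x _ => h x)
    obtain ⟨φ, h1, h2⟩ := exists_dual_eq_zero_of_notMem hcl hx
    rw [hd φ (fun y hy => h1 y (Submodule.mem_sup_left hy))
      (fun z hz => h1 z (Submodule.mem_sup_right hz))] at h2
    exact h2 rfl

theorem isClosed_leftAnnihilator (B : Set (StrongDual ℝ X)) :
    IsClosed (leftAnnihilator B : Set X) := by
  have : (leftAnnihilator B : Set X) = ⋂ b ∈ B, b ⁻¹' {0} := by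
    ext x; simp [leftAnnihilator]
  rw [this]
  exact isClosed_biInter fun b _ => isClosed_singleton.preimage b.continuous

theorem dense_span_iff {A : Set X} : Dense (Submodule.span ℝ A : Set X) ↔
    ∀ φ : StrongDual ℝ X, (∀ a ∈ A, φ a = 0) → φ = 0 := by
  constructor
  · intro h φ hφ
    have h1 : Submodule.span ℝ A ≤ LinearMap.ker φ.toLinearMap := Submodule.span_le.2 hφ
    have := Continuous.ext_on h φ.continuous (0 : StrongDual ℝ X).continuous
      (fun x hx => by simpa using h1 hx)
    exact DFunLike.coe_injective this
  · intro h x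
    by_contra hx
    rw [← Submodule.topologicalClosure_coe, SetLike.mem_coe] at hx
    obtain ⟨φ, h1, h2⟩ := exists_dual_eq_zero_of_notMem
      (Submodule.isClosed_topologicalClosure _) hx
    rw [h φ fun a ha => h1 a (Submodule.le_topologicalClosure _ (Submodule.subset_span ha))] at h2
    exact h2 rfl

/-! ### Membership in the components of a space -/

namespace SetCopy

variable (c : SetCopy X)

theorem mem_carrier {z : ZFSet.{u}} : z ∈ c.carrier ↔ ∃ x, c.pt x = z := by
  simp [carrier]

theorem mem_reals {z : ZFSet.{u}} : z ∈ c.reals ↔ ∃ r, c.real r = z := by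
  simp [reals]

theorem mem_add {a b z : ZFSet.{u}} : ZFSet.pair (ZFSet.pair a b) z ∈ c.add ↔
    ∃ x y, c.pt x = a ∧ c.pt y = b ∧ c.pt (x + y) = z := by
  simp [add, ZFSet.pair_inj, and_assoc]

theorem mem_realAdd {a b z : ZFSet.{u}} : ZFSet.pair (ZFSet.pair a b) z ∈ c.realAdd ↔
    ∃ x y, c.real x = a ∧ c.real y = b ∧ c.real (x + y) = z := by
  simp [realAdd, ZFSet.pair_inj, and_assoc]

theorem mem_norm {a r : ZFSet.{u}} : ZFSet.pair a r ∈ c.norm ↔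
    ∃ x, c.pt x = a ∧ c.real ‖x‖ = r := by
  simp [norm, ZFSet.pair_inj]

theorem mem_realLE {r s : ZFSet.{u}} : ZFSet.pair r s ∈ c.realLE ↔
    ∃ x y, x ≤ y ∧ c.real x = r ∧ c.real y = s := by
  simp only [realLE, ZFSet.mem_range, ZFSet.pair_inj, Subtype.exists, Prod.exists]
  exact ⟨fun ⟨x, y, h, h'⟩ => ⟨x, y, h, h'⟩, fun ⟨x, y, h, h'⟩ => ⟨x, y, h, h'⟩⟩

theorem mem_functional {φ : StrongDual ℝ X} {a r : ZFSet.{u}} :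
    ZFSet.pair a r ∈ c.functional φ ↔ ∃ x, c.pt x = a ∧ c.real (φ x) = r := by
  simp [functional, ZFSet.pair_inj]

theorem pt_real_mem_functional {φ : StrongDual ℝ X} {x : X} {r : ℝ} :
    ZFSet.pair (c.pt x) (c.real r) ∈ c.functional φ ↔ φ x = r := by
  simp [mem_functional]

theorem mem_functionals_univ {f : ZFSet.{u}} :
    f ∈ c.functionals Set.univ ↔ ∃ φ, c.functional φ = f := by
  simp [functionals]

theorem functional_injective : Function.Injective c.functional := by
  intro φ ψ h
  ext x
  have : ZFSet.pair (c.pt x) (c.real (φ x)) ∈ c.functional ψ := by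
    rw [← h, pt_real_mem_functional]
  rw [pt_real_mem_functional] at this
  exact this.symm

end SetCopy

end BanachSpaces

section Elementarity

variable {X : Type u} [NormedAddCommGroup X] [NormedSpace ℝ X]

/-! ### Spaces in elementary substructures -/

theorem mem_elements {θ : Cardinal.{u}} {M : setLanguage.ElementarySubstructure (HSet θ)}
    {x : HSet θ} : x.1 ∈ elements M ↔ x ∈ M := by
  constructor
  · rintro ⟨y, hy, h⟩
    rwa [← HSet.ext_iff.2 h]
  · exact fun h => ⟨x, h, rfl⟩

namespace SetCopy

variable (c : SetCopy X) {θ : Cardinal.{u}}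

/-- The components of a space, with the set of all functionals on it, as elements of `H(θ)`. -/
structure InHSet (θ : Cardinal.{u}) where
  carrier : HSet θ
  carrier_eq : carrier.1 = c.carrier
  add : HSet θ
  add_eq : add.1 = c.add
  smul : HSet θ
  smul_eq : smul.1 = c.smul
  norm : HSet θ
  norm_eq : norm.1 = c.norm
  reals : HSet θ
  reals_eq : reals.1 = c.reals
  realAdd : HSet θ
  realAdd_eq : realAdd.1 = c.realAdd
  realMul : HSet θ
  realMul_eq : realMul.1 = c.realMul
  realLE : HSet θ
  realLE_eq : realLE.1 = c.realLE
  dual : HSet θ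
  dual_eq : dual.1 = c.functionals Set.univ

variable {c}

namespace InHSet

variable (h : c.InHSet θ)

/-- A point of the space as an element of `H(θ)`. -/
noncomputable def pt (x : X) : HSet θ :=
  h.carrier.ofMem (y := c.pt x) (by rw [h.carrier_eq, mem_carrier]; exact ⟨x, rfl⟩)

/-- A real number as an element of `H(θ)`. -/
noncomputable def real (r : ℝ) : HSet θ :=
  h.reals.ofMem (y := c.real r) (by rw [h.reals_eq, mem_reals]; exact ⟨r, rfl⟩)

/-- A functional as an element of `H(θ)`. -/
noncomputable def functional (φ : StrongDual ℝ X) : HSet θ :=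
  h.dual.ofMem (y := c.functional φ) (by rw [h.dual_eq, mem_functionals_univ]; exact ⟨φ, rfl⟩)

@[simp] theorem pt_val (x : X) : (h.pt x).1 = c.pt x := rfl

@[simp] theorem real_val (r : ℝ) : (h.real r).1 = c.real r := rfl

@[simp] theorem functional_val (φ : StrongDual ℝ X) : (h.functional φ).1 = c.functional φ := rfl

/-- The components of the space and its dual belong to `M`. -/
structure Mem (M : setLanguage.ElementarySubstructure (HSet θ)) : Prop where
  carrier : h.carrier ∈ M
  add : h.add ∈ M
  smul : h.smul ∈ M
  norm : h.norm ∈ M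
  reals : h.reals ∈ M
  realAdd : h.realAdd ∈ M
  realMul : h.realMul ∈ M
  realLE : h.realLE ∈ M
  dual : h.dual ∈ M

end InHSet

variable (c) in
theorem exists_forall_nonempty_inHSet :
    ∃ θ₀ : Cardinal.{u}, ∀ θ, θ₀ ≤ θ → Nonempty (c.InHSet θ) := by
  -- Collecting all components in one set gives a single bound `θ₀`; transitivity then yields each
  -- of them.
  obtain ⟨θ₀, hθ₀⟩ := exists_forall_mem_HSet ({c.carrier, c.add, c.smul, c.norm, c.reals,
    c.realAdd, c.realMul, c.realLE, c.functionals Set.univ} : ZFSet.{u})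
  refine ⟨θ₀, fun θ hθ => ?_⟩
  let V : HSet θ := ⟨_, hθ₀ θ hθ⟩
  have hV : ∀ z, z = c.carrier ∨ z = c.add ∨ z = c.smul ∨ z = c.norm ∨ z = c.reals ∨
      z = c.realAdd ∨ z = c.realMul ∨ z = c.realLE ∨ z = c.functionals Set.univ → z ∈ V.1 := by
    intro z hz
    show z ∈ ({c.carrier, c.add, c.smul, c.norm, c.reals, c.realAdd, c.realMul, c.realLE,
      c.functionals Set.univ} : ZFSet.{u})
    simpa only [ZFSet.mem_insert_iff, ZFSet.mem_singleton] using hz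
  exact ⟨⟨V.ofMem (hV c.carrier (by simp)), rfl, V.ofMem (hV c.add (by simp)), rfl,
    V.ofMem (hV c.smul (by simp)), rfl, V.ofMem (hV c.norm (by simp)), rfl,
    V.ofMem (hV c.reals (by simp)), rfl, V.ofMem (hV c.realAdd (by simp)), rfl,
    V.ofMem (hV c.realMul (by simp)), rfl,
    V.ofMem (hV c.realLE (by simp)), rfl, V.ofMem (hV (c.functionals Set.univ) (by simp)), rfl⟩⟩

theorem exists_inHSet {M : setLanguage.ElementarySubstructure (HSet θ)}
    (hc : c.components ⊆ elements M) (hd : c.functionals Set.univ ∈ elements M) :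
    ∃ h : c.InHSet θ, h.Mem M := by
  obtain ⟨x1, h1, e1⟩ := hc (show c.carrier ∈ c.components by simp [components])
  obtain ⟨x2, h2, e2⟩ := hc (show c.add ∈ c.components by simp [components])
  obtain ⟨x3, h3, e3⟩ := hc (show c.norm ∈ c.components by simp [components])
  obtain ⟨x4, h4, e4⟩ := hc (show c.reals ∈ c.components by simp [components])
  obtain ⟨x5, h5, e5⟩ := hc (show c.realAdd ∈ c.components by simp [components])
  obtain ⟨x6, h6, e6⟩ := hc (show c.realLE ∈ c.components by simp [components])
  obtain ⟨x7, h7, e7⟩ := hc (show c.smul ∈ c.components by simp [components])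
  obtain ⟨x9, h9, e9⟩ := hc (show c.realMul ∈ c.components by simp [components])
  obtain ⟨x8, h8, e8⟩ := hd
  exact ⟨⟨x1, e1, x2, e2, x7, e7, x3, e3, x4, e4, x5, e5, x9, e9, x6, e6, x8, e8⟩,
    h1, h2, h7, h3, h4, h5, h9, h6, h8⟩

namespace InHSet

variable {h : c.InHSet θ} {M : setLanguage.ElementarySubstructure (HSet θ)}

/-- Hahn-Banach provides such a functional, and elementarity moves it into `M`. The bound on the
norm is expressed as `φ z ≤ ‖z‖` for all `z`, which needs only the graphs of the norm and of the
order of `ℝ`. -/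
theorem Mem.exists_norming (hM : h.Mem M) {x : X} (hx : h.pt x ∈ M) :
    ∃ φ : StrongDual ℝ X, h.functional φ ∈ M ∧ ‖φ‖ ≤ 1 ∧ φ x = ‖x‖ := by
  obtain ⟨f, hf, h1, ⟨r, h2, h3⟩, h4⟩ := M.exists_mem_of_foDefinable (α := Fin 4)
    (R := fun v f => f.1 ∈ (v 0).1 ∧
      (∃ r : HSet θ, ZFSet.pair (v 3).1 r.1 ∈ (v 1).1 ∧ ZFSet.pair (v 3).1 r.1 ∈ f.1) ∧
      ∀ z r s : HSet θ, ZFSet.pair z.1 r.1 ∈ f.1 → ZFSet.pair z.1 s.1 ∈ (v 1).1 →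
        ZFSet.pair r.1 s.1 ∈ (v 2).1)
    ((HSet.foDefinable_mem _ _).and ((FODefinable.ex ((HSet.foDefinable_pair_mem _ _ _).and
      (HSet.foDefinable_pair_mem _ _ _))).and (FODefinable.all (FODefinable.all (FODefinable.all
        ((HSet.foDefinable_pair_mem _ _ _).imp ((HSet.foDefinable_pair_mem _ _ _).imp
          (HSet.foDefinable_pair_mem _ _ _))))))))
    ![h.dual, h.norm, h.realLE, h.pt x]
    (by
      intro a
      fin_cases a
      exacts [hM.dual, hM.norm, hM.realLE, hx])
    (by
      obtain ⟨φ, hφ, hφx⟩ := exists_dual_vector'' ℝ x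
      refine ⟨h.functional φ, ?_, ⟨h.real ‖x‖, ?_, ?_⟩, ?_⟩
      · show c.functional φ ∈ h.dual.1
        rw [h.dual_eq, mem_functionals_univ]
        exact ⟨φ, rfl⟩
      · show ZFSet.pair (c.pt x) (c.real ‖x‖) ∈ h.norm.1
        rw [h.norm_eq, mem_norm]
        exact ⟨x, rfl, rfl⟩
      · show ZFSet.pair (c.pt x) (c.real ‖x‖) ∈ c.functional φ
        rw [pt_real_mem_functional]
        simpa using hφx
      · intro z r s hr hs
        replace hr : ZFSet.pair z.1 r.1 ∈ c.functional φ := hr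
        replace hs : ZFSet.pair z.1 s.1 ∈ h.norm.1 := hs
        show ZFSet.pair r.1 s.1 ∈ h.realLE.1
        rw [h.norm_eq, mem_norm] at hs
        rw [h.realLE_eq, mem_realLE]
        obtain ⟨y, hy, hs⟩ := hs
        rw [mem_functional] at hr
        obtain ⟨y', hy', hr⟩ := hr
        rw [← hy, c.pt.injective.eq_iff] at hy'
        subst hy'
        refine ⟨_, _, ?_, hr, hs⟩
        have h1 := φ.le_opNorm y'
        have h2 := le_abs_self (φ y')
        rw [Real.norm_eq_abs] at h1
        nlinarith [norm_nonneg y'])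
  replace h1 : f.1 ∈ h.dual.1 := h1
  rw [h.dual_eq, mem_functionals_univ] at h1
  obtain ⟨φ, hφ⟩ := h1
  have hφf : h.functional φ = f := HSet.ext_iff.2 hφ
  have key : ∀ z, φ z ≤ ‖z‖ := by
    intro z
    have := h4 (h.pt z) (h.real (φ z)) (h.real ‖z‖)
      (by rw [← hφ]; exact (pt_real_mem_functional c).2 rfl)
      (by
        show ZFSet.pair (c.pt z) (c.real ‖z‖) ∈ h.norm.1
        rw [h.norm_eq, mem_norm]
        exact ⟨z, rfl, rfl⟩)
    replace this : ZFSet.pair (c.real (φ z)) (c.real ‖z‖) ∈ h.realLE.1 := this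
    rw [h.realLE_eq, mem_realLE] at this
    obtain ⟨a, b, hab, ha, hb⟩ := this
    rwa [c.real.injective ha, c.real.injective hb] at hab
  refine ⟨φ, hφf ▸ hf, ?_, ?_⟩
  · refine φ.opNorm_le_bound zero_le_one fun z => ?_
    rw [one_mul, Real.norm_eq_abs, abs_le]
    have := key (-z)
    rw [map_neg, norm_neg] at this
    exact ⟨by linarith, key z⟩
  · replace h2 : ZFSet.pair (c.pt x) r.1 ∈ h.norm.1 := h2
    replace h3 : ZFSet.pair (c.pt x) r.1 ∈ f.1 := h3
    rw [h.norm_eq, mem_norm] at h2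
    obtain ⟨y, hy, h2⟩ := h2
    rw [c.pt.injective hy] at h2
    rwa [← h2, ← hφ, pt_real_mem_functional] at h3

/-- A point belongs to `M` if it is determined by a membership in the graph of the addition whose
other entries belong to `M`. -/
theorem Mem.exists_add_mem (hM : h.Mem M) (v : Fin 2 → HSet θ) (hv : ∀ i, v i ∈ M)
    (i j k : Fin 2 ⊕ Unit) (x : X) (hx : ZFSet.pair (ZFSet.pair (Sum.elim v (fun _ => h.pt x) i).1
      (Sum.elim v (fun _ => h.pt x) j).1) (Sum.elim v (fun _ => h.pt x) k).1 ∈ c.add)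
    (huniq : ∀ z : HSet θ, ZFSet.pair (ZFSet.pair (Sum.elim v (fun _ => z) i).1
      (Sum.elim v (fun _ => z) j).1) (Sum.elim v (fun _ => z) k).1 ∈ c.add → z = h.pt x) :
    h.pt x ∈ M := by
  obtain ⟨z, hz, h1⟩ := M.exists_mem_of_foDefinable (α := Option (Fin 2))
    (R := fun w z => ZFSet.pair (ZFSet.pair (Sum.elim (fun a => w (some a)) (fun _ => z) i).1
      (Sum.elim (fun a => w (some a)) (fun _ => z) j).1)
      (Sum.elim (fun a => w (some a)) (fun _ => z) k).1 ∈ (w none).1)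
    ((HSet.foDefinable_triple_mem (Sum.map some id i) (Sum.map some id j) (Sum.map some id k)
      (.inl none)).congr fun w => by
        have : ∀ l : Fin 2 ⊕ Unit, Sum.elim (fun a => w (.inl (some a))) (fun _ => w (.inr ())) l =
            w (Sum.map some id l) := by
          rintro (l | l) <;> rfl
        simp only [this])
    (fun a => a.elim h.add v) (by
      rintro (_ | a)
      exacts [hM.add, hv a]) ⟨h.pt x, by
        show _ ∈ h.add.1
        rw [h.add_eq]
        exact hx⟩
  replace h1 : _ ∈ h.add.1 := h1
  rw [h.add_eq] at h1
  rwa [← huniq z h1]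

theorem Mem.pt_zero_mem (hM : h.Mem M) : h.pt 0 ∈ M := by
  -- Zero is the only solution of `z + z = z`; the two parameters are dummies.
  refine hM.exists_add_mem (fun _ => h.carrier) (fun _ => hM.carrier) (.inr ()) (.inr ()) (.inr ())
    0 ?_ fun z hz => ?_
  · exact (mem_add c).2 ⟨0, 0, rfl, rfl, by simp⟩
  · obtain ⟨x, y, h1, h2, h3⟩ := (mem_add c).1 hz
    simp only [Sum.elim_inr] at h1 h2 h3
    have h4 : x + y = y := c.pt.injective (h3.trans h2.symm)
    rw [add_eq_right] at h4
    rw [HSet.ext_iff, ← h1, h4, pt_val]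

theorem Mem.pt_sub_mem (hM : h.Mem M) {x y : X} (hx : h.pt x ∈ M) (hy : h.pt y ∈ M) :
    h.pt (x - y) ∈ M := by
  refine hM.exists_add_mem ![h.pt x, h.pt y] (by
    intro i; fin_cases i; exacts [hx, hy]) (.inr ()) (.inl 1) (.inl 0) _ ?_ fun z hz => ?_
  · exact (mem_add c).2 ⟨x - y, y, rfl, rfl, by simp⟩
  · obtain ⟨x', y', h1, h2, h3⟩ := (mem_add c).1 hz
    replace h2 : c.pt y' = c.pt y := h2
    replace h3 : c.pt (x' + y') = c.pt x := h3
    rw [HSet.ext_iff, ← c.pt.injective h2, ← c.pt.injective h3, pt_val, add_sub_cancel_right]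
    exact h1.symm

theorem Mem.pt_half_mem (hM : h.Mem M) {x : X} (hx : h.pt x ∈ M) : h.pt ((2⁻¹ : ℝ) • x) ∈ M := by
  refine hM.exists_add_mem (fun _ => h.pt x) (fun _ => hx) (.inr ()) (.inr ()) (.inl 0) _ ?_
    fun z hz => ?_
  · refine (mem_add c).2 ⟨(2⁻¹ : ℝ) • x, (2⁻¹ : ℝ) • x, rfl, rfl, ?_⟩
    rw [← two_smul ℝ ((2⁻¹ : ℝ) • x), smul_smul]
    simp
  · obtain ⟨x', y', h1, h2, h3⟩ := (mem_add c).1 hz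
    replace h1 : c.pt x' = z.1 := h1
    replace h2 : c.pt y' = z.1 := h2
    replace h3 : c.pt (x' + y') = c.pt x := h3
    have h4 : x' = y' := c.pt.injective (h1.trans h2.symm)
    subst h4
    rw [HSet.ext_iff, ← c.pt.injective h3, pt_val, ← h1, ← two_smul ℝ x', smul_smul]
    simp

theorem Mem.exists_submodule (hM : h.Mem M) :
    ∃ Y : Submodule ℝ X, (Y : Set X) = closure {x | h.pt x ∈ M} :=
  exists_submodule_coe_eq_closure hM.pt_zero_mem (fun _ hx _ hy => hM.pt_sub_mem hx hy)
    fun _ hx => hM.pt_half_mem hx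

/-- Doubling plays the role of the successor function: the reals `2 ^ n` replace the natural numbers
as indices of enumerations. -/
theorem Mem.real_double_mem (hM : h.Mem M) {r : ℝ} (hr : h.real r ∈ M) : h.real (r + r) ∈ M := by
  obtain ⟨s, hs, h1⟩ := M.exists_mem_of_foDefinable (α := Fin 2)
    (R := fun v s => ZFSet.pair (ZFSet.pair (v 0).1 (v 0).1) s.1 ∈ (v 1).1)
    (HSet.foDefinable_triple_mem _ _ _ _) ![h.real r, h.realAdd]
    (by intro i; fin_cases i; exacts [hr, hM.realAdd])
    ⟨h.real (r + r), by
      show ZFSet.pair (ZFSet.pair (c.real r) (c.real r)) (c.real (r + r)) ∈ h.realAdd.1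
      rw [h.realAdd_eq, mem_realAdd]
      exact ⟨r, r, rfl, rfl, rfl⟩⟩
  replace h1 : ZFSet.pair (ZFSet.pair (c.real r) (c.real r)) s.1 ∈ h.realAdd.1 := h1
  rw [h.realAdd_eq, mem_realAdd] at h1
  obtain ⟨a, b, ha, hb, h1⟩ := h1
  rw [c.real.injective ha, c.real.injective hb] at h1
  rwa [show h.real (r + r) = s from HSet.ext_iff.2 h1]

end InHSet

end SetCopy

end Elementarity

section PlichkoToProjections

/-! ### Weakly Lindelöf determined spaces: the dual generates projections -/

namespace HSet

variable {θ : Cardinal.{u}}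

/-- `f` is a function and the set of those `a ∈ A` at which the functional `y` does not vanish is
covered by the values of `f` on the smallest set which contains `e` and is closed under doubling;
here `p` is the graph of the addition of real numbers. -/
def EnumeratesSupport (p A y e f : HSet θ) : Prop :=
  (∀ t a b : HSet θ, ZFSet.pair t.1 a.1 ∈ f.1 → ZFSet.pair t.1 b.1 ∈ f.1 → a = b) ∧
  ∀ B : HSet θ, e.1 ∈ B.1 →
    (∀ r s : HSet θ, r.1 ∈ B.1 → ZFSet.pair (ZFSet.pair r.1 r.1) s.1 ∈ p.1 → s.1 ∈ B.1) →
    ∀ a : HSet θ, a.1 ∈ A.1 →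
      (∃ r : HSet θ, ZFSet.pair a.1 r.1 ∈ y.1 ∧ ¬ ZFSet.pair (ZFSet.pair r.1 r.1) r.1 ∈ p.1) →
      ∃ t : HSet θ, t.1 ∈ B.1 ∧ ZFSet.pair t.1 a.1 ∈ f.1

theorem foDefinable_enumeratesSupport {α : Type} (p A y e f : α) :
    FODefinable setLanguage fun v : α → HSet θ =>
      EnumeratesSupport (v p) (v A) (v y) (v e) (v f) := by
  refine FODefinable.and (FODefinable.all (FODefinable.all (FODefinable.all ?_)))
    (FODefinable.all (FODefinable.imp (foDefinable_mem _ _) (FODefinable.imp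
      (FODefinable.all (FODefinable.all ?_)) (FODefinable.all (FODefinable.imp (foDefinable_mem _ _)
        (FODefinable.imp (FODefinable.ex ?_) (FODefinable.ex ?_)))))))
  · exact (foDefinable_pair_mem _ _ _).imp ((foDefinable_pair_mem _ _ _).imp (FODefinable.eq _ _))
  · exact (foDefinable_mem _ _).imp ((foDefinable_triple_mem _ _ _ _).imp (foDefinable_mem _ _))
  · exact (foDefinable_pair_mem _ _ _).and (foDefinable_triple_mem _ _ _ _).not
  · exact (foDefinable_mem _ _).and (foDefinable_pair_mem _ _ _)

/-- `A ⊆ C` separates the functionals in `D`, and every functional in `D` has countable support on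
`A`. -/
def IsPlichkoSet (C D R p A : HSet θ) : Prop :=
  (∀ a : HSet θ, a.1 ∈ A.1 → a.1 ∈ C.1) ∧
  (∀ y z : HSet θ, y.1 ∈ D.1 → z.1 ∈ D.1 → (∀ a r : HSet θ, a.1 ∈ A.1 →
    ZFSet.pair a.1 r.1 ∈ y.1 → ZFSet.pair a.1 r.1 ∈ z.1) → y = z) ∧
  ∀ y : HSet θ, y.1 ∈ D.1 → ∃ e f : HSet θ, e.1 ∈ R.1 ∧ EnumeratesSupport p A y e f

theorem foDefinable_isPlichkoSet {α : Type} (C D R p A : α) :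
    FODefinable setLanguage fun v : α → HSet θ =>
      IsPlichkoSet (v C) (v D) (v R) (v p) (v A) := by
  refine FODefinable.and (FODefinable.all ?_) (FODefinable.and
    (FODefinable.all (FODefinable.all ?_)) (FODefinable.all (FODefinable.imp (foDefinable_mem _ _)
      (FODefinable.ex (FODefinable.ex ?_)))))
  · exact (foDefinable_mem _ _).imp (foDefinable_mem _ _)
  · exact (foDefinable_mem _ _).imp ((foDefinable_mem _ _).imp ((FODefinable.all (FODefinable.all
      ((foDefinable_mem _ _).imp ((foDefinable_pair_mem _ _ _).imp
        (foDefinable_pair_mem _ _ _))))).imp (FODefinable.eq _ _)))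
  · exact (foDefinable_mem _ _).and (foDefinable_enumeratesSupport _ _ _ _ _)

end HSet

variable {X : Type u} [NormedAddCommGroup X] [NormedSpace ℝ X]

namespace SetCopy

variable {c : SetCopy X} {θ : Cardinal.{u}}

namespace InHSet

variable {h : c.InHSet θ}

/-- Quantifiers here range over `H(θ)` only, so the enumerations of the supports must be found
there. They are subsets of `ℝ × X`, which `hprod` places in `H(θ)`. -/
theorem exists_isPlichkoSet (hprod : Cardinal.mk (transClosure (ZFSet.prod c.reals c.carrier)) <
      Cardinal.lift.{u + 1} θ) (hX : IsWLD X) :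
    ∃ A : HSet θ, HSet.IsPlichkoSet h.carrier h.dual h.reals h.realAdd A := by
  obtain ⟨-, A, hA, hcount⟩ := hX
  rw [dense_span_iff] at hA
  let AH : HSet θ := h.carrier.ofSubset (y := ZFSet.range fun a : A => c.pt a) (by
    intro z hz
    obtain ⟨a, rfl⟩ := ZFSet.mem_range.1 hz
    rw [h.carrier_eq, mem_carrier]
    exact ⟨a, rfl⟩)
  have hAH : ∀ z : ZFSet.{u}, z ∈ AH.1 ↔ ∃ a ∈ A, c.pt a = z := by
    intro z
    show z ∈ ZFSet.range (fun a : A => c.pt a) ↔ _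
    simp
  refine ⟨AH, ?_, ?_, ?_⟩
  · intro a ha
    obtain ⟨x, -, hx⟩ := (hAH _).1 ha
    rw [h.carrier_eq, mem_carrier]
    exact ⟨x, hx⟩
  · intro y z hy hz hyz
    rw [h.dual_eq, mem_functionals_univ] at hy hz
    obtain ⟨φ, hφ⟩ := hy
    obtain ⟨ψ, hψ⟩ := hz
    rw [HSet.ext_iff, ← hφ, ← hψ]
    congr 1
    rw [← sub_eq_zero]
    refine hA _ fun a ha => ?_
    have := hyz (h.pt a) (h.real (φ a)) ((hAH _).2 ⟨a, ha, rfl⟩)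
      (by rw [← hφ]; exact (pt_real_mem_functional c).2 rfl)
    rw [← hψ] at this
    have := (pt_real_mem_functional c).1 this
    simp [this]
  · intro y hy
    rw [h.dual_eq, mem_functionals_univ] at hy
    obtain ⟨φ, hφ⟩ := hy
    obtain ⟨a, ha⟩ : ∃ a : ℕ → X, {x | x ∈ A ∧ φ x ≠ 0} ⊆ Set.range a := by
      rcases Set.eq_empty_or_nonempty {x | x ∈ A ∧ φ x ≠ 0} with h0 | h0
      · exact ⟨fun _ => 0, by rw [h0]; exact Set.empty_subset _⟩
      · obtain ⟨a, ha⟩ := (hcount φ trivial).exists_eq_range h0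
        exact ⟨a, ha.le⟩
    -- The graph of `2 ^ n ↦ a n`, a function because the powers of two are distinct.
    let f : HSet θ := HSet.ofSubset ⟨ZFSet.prod c.reals c.carrier, hprod⟩
      (y := ZFSet.range fun n : ℕ => ZFSet.pair (c.real (2 ^ n)) (c.pt (a n))) (by
        intro z hz
        obtain ⟨n, rfl⟩ := ZFSet.mem_range.1 hz
        exact ZFSet.pair_mem_prod.2 ⟨(mem_reals c).2 ⟨_, rfl⟩, (mem_carrier c).2 ⟨_, rfl⟩⟩)
    have hf : ∀ t b : ZFSet.{u}, ZFSet.pair t b ∈ f.1 ↔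
        ∃ n : ℕ, c.real (2 ^ n) = t ∧ c.pt (a n) = b := by
      intro t b
      show _ ∈ ZFSet.range _ ↔ _
      simp [ZFSet.pair_inj]
    refine ⟨h.real 1, f, ?_, ?_, ?_⟩
    · rw [h.reals_eq, mem_reals]
      exact ⟨1, rfl⟩
    · intro t b b' h1 h2
      obtain ⟨n, hn, hb⟩ := (hf _ _).1 h1
      obtain ⟨m, hm, hb'⟩ := (hf _ _).1 h2
      have h3 : (2 : ℝ) ^ n = 2 ^ m := c.real.injective (hn.trans hm.symm)
      have h4 : n = m := pow_right_injective₀ (by norm_num) (by norm_num) h3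
      rw [HSet.ext_iff, ← hb, ← hb', h4]
    · intro B he hB b hb hr
      obtain ⟨r, hr, hne⟩ := hr
      obtain ⟨x, hx, hxb⟩ := (hAH _).1 hb
      rw [← hφ, ← hxb, mem_functional] at hr
      obtain ⟨x', hx', hr⟩ := hr
      rw [c.pt.injective.eq_iff] at hx'
      subst hx'
      -- Vanishing of the value `r` is encoded as `r + r = r`.
      have hφx : φ x' ≠ 0 := by
        intro h0
        apply hne
        rw [h.realAdd_eq, mem_realAdd]
        exact ⟨φ x', φ x', hr, hr, by rw [← hr, h0, add_zero]⟩
      obtain ⟨n, hn⟩ := ha ⟨hx, hφx⟩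
      have hpow : ∀ n : ℕ, (h.real (2 ^ n)).1 ∈ B.1 := by
        intro n
        induction n with
        | zero => simpa using he
        | succ n ih =>
          refine hB _ _ ih ?_
          rw [h.realAdd_eq, mem_realAdd]
          exact ⟨_, _, rfl, rfl, by rw [pow_succ, mul_two]; rfl⟩
      exact ⟨_, hpow n, (hf _ _).2 ⟨n, rfl, by rw [hn, hxb]⟩⟩

theorem Mem.decomposes [CompleteSpace X] {M : setLanguage.ElementarySubstructure (HSet θ)}
    (hM : h.Mem M)
    (hprod : Cardinal.mk (transClosure (ZFSet.prod c.reals c.carrier)) < Cardinal.lift.{u + 1} θ)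
    (hX : IsWLD X) : c.Decomposes Set.univ (elements M) := by
  obtain ⟨A, hAM, hA⟩ := M.exists_mem_of_foDefinable (α := Fin 4)
    (R := fun v A => HSet.IsPlichkoSet (v 0) (v 1) (v 2) (v 3) A)
    (HSet.foDefinable_isPlichkoSet _ _ _ _ _) ![h.carrier, h.dual, h.reals, h.realAdd]
    (by intro i; fin_cases i; exacts [hM.carrier, hM.dual, hM.reals, hM.realAdd])
    (exists_isPlichkoSet hprod hX)
  obtain ⟨hAC, hAsep, hAcount⟩ : HSet.IsPlichkoSet h.carrier h.dual h.reals h.realAdd A := hA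
  obtain ⟨Y, hY⟩ := hM.exists_submodule
  have hpt : ∀ x, c.pt x ∈ elements M ↔ h.pt x ∈ M := fun x => mem_elements (x := h.pt x)
  have hfun : ∀ φ, c.functional φ ∈ elements M ↔ h.functional φ ∈ M :=
    fun φ => mem_elements (x := h.functional φ)
  have hset : {x | c.pt x ∈ elements M} = {x | h.pt x ∈ M} := Set.ext hpt
  have hYc : IsClosed (Y : Set X) := by rw [hY]; exact isClosed_closure
  refine ⟨Y, by rw [hset, hY], isCompl_of_norm_le_norm_add hYc (isClosed_leftAnnihilator _) ?_ ?_⟩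
  · intro y hy z hz
    rw [← SetLike.mem_coe, hY] at hy
    refine closure_minimal (s := {x | h.pt x ∈ M}) (t := {y | ‖y‖ ≤ ‖y + z‖}) ?_
      (isClosed_le continuous_norm (continuous_norm.comp (continuous_add_const z))) hy
    intro x hx
    obtain ⟨φ, hφM, hφ1, hφx⟩ := hM.exists_norming hx
    have hz0 : φ z = 0 := hz φ ⟨trivial, (hfun φ).2 hφM⟩
    calc ‖x‖ = φ (x + z) := by rw [map_add, hz0, hφx, add_zero]
      _ ≤ ‖φ (x + z)‖ := le_abs_self _
      _ ≤ ‖φ‖ * ‖x + z‖ := φ.le_opNorm _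
      _ ≤ ‖x + z‖ := mul_le_of_le_one_left (norm_nonneg _) hφ1
  · intro φ hφY hφZ
    have hdual : ∀ ψ, (h.functional ψ).1 ∈ h.dual.1 := fun ψ => by
      rw [h.dual_eq, mem_functionals_univ]; exact ⟨ψ, rfl⟩
    have := hAsep (h.functional φ) (h.functional 0) (hdual _) (hdual _) ?_
    · exact functional_injective c (HSet.ext_iff.1 this)
    intro a r ha hr
    have ha' := hAC a ha
    rw [h.carrier_eq, mem_carrier] at ha'
    obtain ⟨x, hx⟩ := ha'
    have hax : a = h.pt x := HSet.ext_iff.2 hx.symm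
    subst hax
    suffices hφx : φ x = 0 by
      obtain ⟨x', hx', hr⟩ := (mem_functional c).1 hr
      rw [c.pt.injective hx', hφx] at hr
      exact (mem_functional c).2 ⟨x, rfl, by simpa using hr⟩
    by_cases hxM : h.pt x ∈ M
    · exact hφY x (by rw [← SetLike.mem_coe, hY]; exact subset_closure hxM)
    -- It remains to place a point of `A` outside `M` in the annihilator: if some `ψ` in `M` were
    -- nonzero at `x`, then `x` would be a term of an enumeration in `M`, hence in `M`.
    refine hφZ x fun ψ hψ => ?_
    by_contra hne
    have hψM := (hfun ψ).1 hψ.2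
    apply hxM
    obtain ⟨e, heM, f, heR, hef⟩ := M.exists_mem_of_foDefinable (α := Fin 4)
      (R := fun v e => ∃ f : HSet θ,
        e.1 ∈ (v 0).1 ∧ HSet.EnumeratesSupport (v 1) (v 2) (v 3) e f)
      (FODefinable.ex ((HSet.foDefinable_mem _ _).and
        (HSet.foDefinable_enumeratesSupport _ _ _ _ _)))
      ![h.reals, h.realAdd, A, h.functional ψ]
      (by intro i; fin_cases i; exacts [hM.reals, hM.realAdd, hAM, hψM])
      (hAcount (h.functional ψ) (hdual ψ))
    obtain ⟨f, hfM, hf⟩ := M.exists_mem_of_foDefinable (α := Fin 4)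
      (R := fun v f => HSet.EnumeratesSupport (v 0) (v 1) (v 2) (v 3) f)
      (HSet.foDefinable_enumeratesSupport _ _ _ _ _)
      ![h.realAdd, A, h.functional ψ, e]
      (by intro i; fin_cases i; exacts [hM.realAdd, hAM, hψM, heM])
      ⟨f, hef⟩
    replace hf : HSet.EnumeratesSupport h.realAdd A (h.functional ψ) e f := hf
    replace heR : e.1 ∈ h.reals.1 := heR
    -- The test set is `ℝ ∩ M`. It need only lie in `H(θ)`, not in `M`; it contains `e` and is
    -- closed under doubling, so the index `t` of `x` is in `M`.
    let B : HSet θ := h.reals.ofSubset (y := ZFSet.sep (· ∈ elements M) h.reals.1)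
      (fun z hz => (ZFSet.mem_sep.1 hz).1)
    have hB : ∀ z : ZFSet.{u}, z ∈ B.1 ↔ z ∈ h.reals.1 ∧ z ∈ elements M :=
      fun z => ZFSet.mem_sep
    obtain ⟨t, htB, htf⟩ := hf.2 B ((hB _).2 ⟨heR, mem_elements.2 heM⟩) (by
      intro r s hr hs
      rw [hB] at hr ⊢
      rw [h.realAdd_eq, mem_realAdd] at hs
      obtain ⟨a, b, ha, hb, hs⟩ := hs
      have hab : a = b := c.real.injective (ha.trans hb.symm)
      subst hab
      have hra : h.real a = r := HSet.ext_iff.2 ha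
      have h1 : h.real a ∈ M := hra ▸ mem_elements.1 hr.2
      have h2 := hM.real_double_mem h1
      rw [← hs]
      refine ⟨?_, mem_elements.2 h2⟩
      rw [h.reals_eq, mem_reals]
      exact ⟨_, rfl⟩) (h.pt x) ha ⟨h.real (ψ x), (pt_real_mem_functional c).2 rfl, by
        rw [h.realAdd_eq, mem_realAdd]
        rintro ⟨a, b, h1, h2, h3⟩
        have h1' := c.real.injective h1
        have h2' := c.real.injective h2
        have h3' := c.real.injective h3
        rw [h1', h2'] at h3'
        exact hne (by linarith)⟩
    have htM : t ∈ M := mem_elements.1 ((hB _).1 htB).2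
    obtain ⟨b, hbM, hb⟩ := M.exists_mem_of_foDefinable (α := Fin 2)
      (R := fun v b => ZFSet.pair (v 0).1 b.1 ∈ (v 1).1)
      (HSet.foDefinable_pair_mem _ _ _) ![t, f]
      (by intro i; fin_cases i; exacts [htM, hfM]) ⟨h.pt x, htf⟩
    rwa [hf.1 t (h.pt x) b htf hb]

end InHSet

theorem generatesProjections_of_isWLD [CompleteSpace X] (c : SetCopy X) (hX : IsWLD X) :
    c.GeneratesProjections (Set.univ : Set (StrongDual ℝ X)) := by
  refine ⟨by simpa using hX.1, ?_⟩
  obtain ⟨θ₀, hθ₀⟩ := exists_forall_mem_HSet (ZFSet.prod c.reals c.carrier)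
  refine ⟨θ₀, fun θ hθ _ M _ hc hd => ?_⟩
  obtain ⟨h, hM⟩ := exists_inHSet hc hd
  exact hM.decomposes (hθ₀ θ hθ) hX

end SetCopy

end PlichkoToProjections

section ProjectionHulls

open Filter Topology

/-! ### Families of projections indexed by hulls -/

/-- A finitary hull operation on sets of points of `X` and functionals on `X`, under which the hulls
of countable sets are countable and decompose the space `X`. -/
structure ProjectionHull (X : Type u) [NormedAddCommGroup X] [NormedSpace ℝ X] where
  hull : Set (X ⊕ StrongDual ℝ X) → Set (X ⊕ StrongDual ℝ X)
  subset_hull : ∀ s, s ⊆ hull s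
  mono : Monotone hull
  finitary : ∀ s, ∀ e ∈ hull s, ∃ t, t ⊆ s ∧ t.Finite ∧ e ∈ hull t
  countable : ∀ s, s.Countable → (hull s).Countable
  norming : ∀ s, s.Countable → ∀ x, .inl x ∈ hull s →
    ∃ φ : StrongDual ℝ X, .inr φ ∈ hull s ∧ ‖φ‖ ≤ 1 ∧ φ x = ‖x‖
  decomposes : ∀ s, s.Countable → ∃ Y : Submodule ℝ X,
    (Y : Set X) = closure {x | .inl x ∈ hull s} ∧ IsCompl Y (leftAnnihilator {φ | .inr φ ∈ hull s})

namespace ProjectionHull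

variable {X : Type u} [NormedAddCommGroup X] [NormedSpace ℝ X] (G : ProjectionHull X)

/-- The points in the hull. -/
def pts (s : Set (X ⊕ StrongDual ℝ X)) : Set X := {x | .inl x ∈ G.hull s}

/-- The functionals in the hull. -/
def fns (s : Set (X ⊕ StrongDual ℝ X)) : Set (StrongDual ℝ X) := {φ | .inr φ ∈ G.hull s}

variable {G} {s t : Set (X ⊕ StrongDual ℝ X)}

theorem pts_mono (h : s ⊆ t) : G.pts s ⊆ G.pts t := fun _ hx => G.mono h hx

theorem fns_mono (h : s ⊆ t) : G.fns s ⊆ G.fns t := fun _ hx => G.mono h hx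

theorem closure_pts_mono (h : s ⊆ t) : closure (G.pts s) ⊆ closure (G.pts t) :=
  closure_mono (pts_mono h)

theorem leftAnnihilator_fns_anti (h : s ⊆ t) {x : X} (hx : x ∈ leftAnnihilator (G.fns t)) :
    x ∈ leftAnnihilator (G.fns s) := fun φ hφ => hx φ (fns_mono h hφ)

theorem exists_finite_of_mem_pts {x : X} (hx : x ∈ G.pts s) : ∃ t ⊆ s, t.Finite ∧ x ∈ G.pts t :=
  G.finitary s _ hx

theorem exists_finite_of_mem_fns {φ : StrongDual ℝ X} (hφ : φ ∈ G.fns s) :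
    ∃ t ⊆ s, t.Finite ∧ φ ∈ G.fns t :=
  G.finitary s _ hφ

/-- No countability is needed: each point of the hull lies in the hull of a finite subset, which
also contains a norming functional for it. -/
theorem norm_le_norm_add {x z : X} (hx : x ∈ closure (G.pts s))
    (hz : z ∈ leftAnnihilator (G.fns s)) : ‖x‖ ≤ ‖x + z‖ := by
  refine closure_minimal (s := G.pts s) (t := {y | ‖y‖ ≤ ‖y + z‖}) ?_
    (isClosed_le continuous_norm (continuous_norm.comp (continuous_add_const z))) hx
  intro x hx
  obtain ⟨t, hts, ht, hxt⟩ := exists_finite_of_mem_pts hx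
  obtain ⟨φ, hφt, hφ1, hφx⟩ := G.norming t ht.countable x hxt
  have hz0 : φ z = 0 := hz φ (fns_mono hts hφt)
  calc ‖x‖ = φ (x + z) := by rw [map_add, hz0, hφx, add_zero]
    _ ≤ ‖φ (x + z)‖ := le_abs_self _
    _ ≤ ‖φ‖ * ‖x + z‖ := φ.le_opNorm _
    _ ≤ ‖x + z‖ := mul_le_of_le_one_left (norm_nonneg _) hφ1

theorem exists_submodule_coe_eq_closure_pts (G : ProjectionHull X)
    (s : Set (X ⊕ StrongDual ℝ X)) : ∃ Y : Submodule ℝ X, (Y : Set X) = closure (G.pts s) := by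
  rw [← closure_closure (s := G.pts s)]
  apply exists_submodule_coe_eq_closure
  · obtain ⟨Y, hY, -⟩ := G.decomposes ∅ Set.countable_empty
    refine closure_pts_mono (Set.empty_subset s) ?_
    show (0 : X) ∈ closure {x | .inl x ∈ G.hull ∅}
    rw [← hY]
    exact Y.zero_mem
  · intro x hx y hy
    refine map_mem_closure₂ (f := fun a b : X => a - b) continuous_sub hx hy
      (u := closure (G.pts s)) (fun a ha b hb => ?_) |> fun h => by rwa [closure_closure] at h
    obtain ⟨t, hts, ht, hat⟩ := exists_finite_of_mem_pts ha
    obtain ⟨t', hts', ht', hbt⟩ := exists_finite_of_mem_pts hb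
    obtain ⟨Y, hY, -⟩ := G.decomposes (t ∪ t') (ht.union ht').countable
    refine closure_pts_mono (Set.union_subset hts hts') ?_
    show a - b ∈ closure {x | .inl x ∈ G.hull (t ∪ t')}
    rw [← hY]
    refine Y.sub_mem ?_ ?_
    · rw [← SetLike.mem_coe, hY]
      exact subset_closure (pts_mono Set.subset_union_left hat)
    · rw [← SetLike.mem_coe, hY]
      exact subset_closure (pts_mono Set.subset_union_right hbt)
  · intro x hx
    refine map_mem_closure (f := fun a : X => (2⁻¹ : ℝ) • a) (continuous_const_smul _) hx
      (t := closure (G.pts s)) (fun a ha => ?_) |> fun h => by rwa [closure_closure] at h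
    obtain ⟨t, hts, ht, hat⟩ := exists_finite_of_mem_pts ha
    obtain ⟨Y, hY, -⟩ := G.decomposes t ht.countable
    refine closure_pts_mono hts ?_
    show (2⁻¹ : ℝ) • a ∈ closure {x | .inl x ∈ G.hull t}
    rw [← hY]
    refine Y.smul_mem _ ?_
    rw [← SetLike.mem_coe, hY]
    exact subset_closure hat

variable (G) in
/-- The norm closure of the points in the hull, a linear subspace. -/
noncomputable def space (s : Set (X ⊕ StrongDual ℝ X)) : Submodule ℝ X :=
  (G.exists_submodule_coe_eq_closure_pts s).choose

theorem coe_space : (G.space s : Set X) = closure (G.pts s) :=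
  (G.exists_submodule_coe_eq_closure_pts s).choose_spec

theorem pts_subset_space {x : X} (hx : x ∈ G.pts s) : x ∈ G.space s := by
  rw [← SetLike.mem_coe, coe_space]; exact subset_closure hx

theorem space_mono (h : s ⊆ t) : G.space s ≤ G.space t := by
  intro x
  rw [← SetLike.mem_coe, ← SetLike.mem_coe, coe_space, coe_space]
  exact fun hx => closure_pts_mono h hx

theorem space_le_iff {V : Submodule ℝ X} (hV : IsClosed (V : Set X)) :
    G.space s ≤ V ↔ G.pts s ⊆ V := by
  rw [← SetLike.coe_subset_coe, coe_space, hV.closure_subset_iff]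

variable (G) in
/-- `a` is the image of `x` under the projection associated with the hull of `s`. -/
def IsProj (s : Set (X ⊕ StrongDual ℝ X)) (x a : X) : Prop :=
  a ∈ G.space s ∧ x - a ∈ leftAnnihilator (G.fns s)

namespace IsProj

variable {x y a b : X}

theorem norm_le (h : G.IsProj s x a) : ‖a‖ ≤ ‖x‖ := by
  have h1 := h.1
  rw [← SetLike.mem_coe, coe_space] at h1
  simpa using norm_le_norm_add h1 h.2

theorem add (h : G.IsProj s x a) (h' : G.IsProj s y b) : G.IsProj s (x + y) (a + b) :=
  ⟨add_mem h.1 h'.1, by rw [add_sub_add_comm]; exact add_mem h.2 h'.2⟩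

theorem smul (r : ℝ) (h : G.IsProj s x a) : G.IsProj s (r • x) (r • a) :=
  ⟨Submodule.smul_mem _ _ h.1, by rw [← smul_sub]; exact Submodule.smul_mem _ _ h.2⟩

theorem sub (h : G.IsProj s x a) (h' : G.IsProj s y b) : G.IsProj s (x - y) (a - b) :=
  ⟨sub_mem h.1 h'.1, by rw [sub_sub_sub_comm]; exact sub_mem h.2 h'.2⟩

theorem unique (h : G.IsProj s x a) (h' : G.IsProj s x b) : a = b := by
  have := (h.sub h').norm_le
  rw [sub_self, norm_zero, norm_le_zero_iff, sub_eq_zero] at this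
  exact this

theorem of_mem (h : x ∈ G.space s) : G.IsProj s x x :=
  ⟨h, by rw [sub_self]; exact zero_mem _⟩

theorem trans (hst : s ⊆ t) (hb : G.IsProj t x b) (ha : G.IsProj s x a) : G.IsProj s b a := by
  refine ⟨ha.1, ?_⟩
  have := sub_mem ha.2 (leftAnnihilator_fns_anti hst hb.2)
  rwa [sub_sub_sub_cancel_left] at this

end IsProj

theorem exists_mem_pts_of_mem_pts_iUnion {ι : Type*} [Preorder ι] [IsDirectedOrder ι] [Nonempty ι]
    {S : ι → Set (X ⊕ StrongDual ℝ X)} (hS : Monotone S) {x : X} (hx : x ∈ G.pts (⋃ i, S i)) :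
    ∃ i, x ∈ G.pts (S i) := by
  obtain ⟨t, hts, ht, hxt⟩ := exists_finite_of_mem_pts hx
  obtain ⟨I, hI, htI⟩ := Set.finite_subset_iUnion ht hts
  obtain ⟨i, hi⟩ := hI.exists_le
  exact ⟨i, pts_mono (htI.trans (Set.iUnion₂_subset fun j hj => hS (hi j hj))) hxt⟩

/-- Approximate `b` by a point `y` of some stage. Later projections fix `y` and send `b` to `a j`,
and they do not increase norms, so `‖a j - y‖ ≤ ‖b - y‖`. -/
theorem tendsto_of_isProj {ι : Type*} [Preorder ι] [IsDirectedOrder ι] [Nonempty ι]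
    {S : ι → Set (X ⊕ StrongDual ℝ X)} (hS : Monotone S) {x b : X} {a : ι → X}
    (ha : ∀ i, G.IsProj (S i) x (a i)) (hb : G.IsProj (⋃ i, S i) x b) :
    Tendsto a atTop (𝓝 b) := by
  rw [Metric.tendsto_nhds]
  intro ε hε
  have hb1 := hb.1
  rw [← SetLike.mem_coe, coe_space, Metric.mem_closure_iff] at hb1
  obtain ⟨y, hy, hby⟩ := hb1 (ε / 2) (half_pos hε)
  obtain ⟨i, hi⟩ := exists_mem_pts_of_mem_pts_iUnion hS hy
  filter_upwards [eventually_ge_atTop i] with j hj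
  have h1 : G.IsProj (S j) y y := IsProj.of_mem (pts_subset_space (pts_mono (hS hj) hi))
  have h2 : G.IsProj (S j) b (a j) := hb.trans (Set.subset_iUnion S j) (ha j)
  have h3 := (h2.sub h1).norm_le
  rw [dist_eq_norm] at hby ⊢
  calc ‖a j - b‖ = ‖(a j - y) - (b - y)‖ := by rw [sub_sub_sub_cancel_right]
    _ ≤ ‖a j - y‖ + ‖b - y‖ := norm_sub_le _ _
    _ < ε := by linarith

theorem exists_isProj_of_countable (G : ProjectionHull X) (hs : s.Countable) (x : X) :
    ∃ a, G.IsProj s x a := by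
  obtain ⟨Y, hY, hc⟩ := G.decomposes s hs
  have hYs : Y = G.space s := SetLike.coe_injective (by rw [hY, coe_space]; rfl)
  have hx : x ∈ Y ⊔ leftAnnihilator {φ | .inr φ ∈ G.hull s} := by
    rw [codisjoint_iff.1 hc.codisjoint]; trivial
  obtain ⟨a, ha, b, hb, rfl⟩ := Submodule.mem_sup.1 hx
  exact ⟨a, hYs ▸ ha, by rw [add_sub_cancel_left]; exact hb⟩

/-- The projections of `x` for countable `t ⊆ s` form a net that converges along increasing
sequences, so it is Cauchy. Countable sets being closed under countable unions, the net is even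
eventually constant, and its final value is the projection for `s`. -/
theorem exists_isProj (G : ProjectionHull X) (s : Set (X ⊕ StrongDual ℝ X)) (x : X) :
    ∃ a, G.IsProj s x a := by
  let T := {t : Set (X ⊕ StrongDual ℝ X) // t.Countable ∧ t ⊆ s}
  choose a ha using fun t : T => G.exists_isProj_of_countable t.2.1 x
  let U : (ℕ → T) → T := fun t => ⟨⋃ n, (t n).1, Set.countable_iUnion fun n => (t n).2.1,
    Set.iUnion_subset fun n => (t n).2.2⟩
  have hcauchy : ∀ ε : ℝ, 0 < ε → ∃ t : T, ∀ t', t ≤ t' → ‖a t' - a t‖ < ε := by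
    by_contra! hcon
    obtain ⟨ε, hε, hcon⟩ := hcon
    choose f hf hfa using hcon
    let t : ℕ → T := fun n => f^[n] ⟨∅, Set.countable_empty, Set.empty_subset s⟩
    have ht : ∀ n, t (n + 1) = f (t n) := fun n => Function.iterate_succ_apply' _ _ _
    have hmono : Monotone fun n => (t n).1 :=
      monotone_nat_of_le_succ fun n => by rw [ht]; exact hf (t n)
    have hlim : Tendsto (fun n => a (t n)) atTop (𝓝 (a (U t))) :=
      tendsto_of_isProj hmono (fun n => ha (t n)) (ha (U t))
    have h0 := ((hlim.comp (tendsto_add_atTop_nat 1)).sub hlim).norm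
    rw [sub_self, norm_zero] at h0
    refine absurd (ge_of_tendsto' h0 fun n => ?_) (not_le.2 hε)
    simp only [Function.comp, ht]
    exact hfa (t n)
  choose t ht using fun n : ℕ => hcauchy (1 / ((n : ℝ) + 1)) Nat.one_div_pos_of_nat
  have hstable : ∀ t', U t ≤ t' → a t' = a (U t) := by
    intro t' ht'
    have hle : ∀ n, t n ≤ U t := fun n => Set.subset_iUnion (fun n => (t n).1) n
    rw [← sub_eq_zero, ← norm_le_zero_iff]
    have hlim : Tendsto (fun n : ℕ => 1 / ((n : ℝ) + 1) + 1 / ((n : ℝ) + 1)) atTop (𝓝 (0 + 0)) :=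
      tendsto_one_div_add_atTop_nhds_zero_nat.add tendsto_one_div_add_atTop_nhds_zero_nat
    rw [add_zero] at hlim
    refine ge_of_tendsto' hlim fun n => ?_
    rw [← sub_sub_sub_cancel_right _ _ (a (t n))]
    exact (norm_sub_le _ _).trans
      (add_le_add (ht n t' ((hle n).trans ht')).le (ht n _ (hle n)).le)
  refine ⟨a (U t), space_mono (U t).2.2 (ha (U t)).1, fun φ hφ => ?_⟩
  obtain ⟨v, hvs, hv, hφv⟩ := exists_finite_of_mem_fns hφ
  -- Adding `v` brings `φ` into the hull without changing the stable value.
  let t' : T := ⟨(U t).1 ∪ v, (U t).2.1.union hv.countable, Set.union_subset (U t).2.2 hvs⟩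
  rw [← hstable t' (show (U t).1 ⊆ (U t).1 ∪ v from Set.subset_union_left)]
  exact (ha t').2 φ (fns_mono (show v ⊆ (U t).1 ∪ v from Set.subset_union_right) hφv)

variable (G) in
/-- The projection associated with the hull of `s`. -/
noncomputable def proj (s : Set (X ⊕ StrongDual ℝ X)) : X →L[ℝ] X :=
  LinearMap.mkContinuous
    { toFun := fun x => (G.exists_isProj s x).choose
      map_add' := fun x y => (G.exists_isProj s (x + y)).choose_spec.unique
        ((G.exists_isProj s x).choose_spec.add (G.exists_isProj s y).choose_spec)
      map_smul' := fun r x => (G.exists_isProj s (r • x)).choose_spec.unique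
        ((G.exists_isProj s x).choose_spec.smul r) } 1
    fun x => by
      rw [one_mul]
      exact (G.exists_isProj s x).choose_spec.norm_le

theorem isProj_proj (x : X) : G.IsProj s x (G.proj s x) := (G.exists_isProj s x).choose_spec

theorem proj_mem (x : X) : G.proj s x ∈ G.space s := (isProj_proj x).1

theorem proj_of_mem {x : X} (h : x ∈ G.space s) : G.proj s x = x :=
  (isProj_proj x).unique (IsProj.of_mem h)

theorem proj_proj_of_subset (h : s ⊆ t) (x : X) : G.proj s (G.proj t x) = G.proj s x :=
  (isProj_proj _).unique ((isProj_proj x).trans h (isProj_proj x))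

theorem proj_proj_of_superset (h : s ⊆ t) (x : X) : G.proj t (G.proj s x) = G.proj s x :=
  proj_of_mem (space_mono h (proj_mem x))

theorem tendsto_proj {ι : Type*} [Preorder ι] [IsDirectedOrder ι] [Nonempty ι]
    {S : ι → Set (X ⊕ StrongDual ℝ X)} (hS : Monotone S) (x : X) :
    Tendsto (fun i => G.proj (S i) x) atTop (𝓝 (G.proj (⋃ i, S i) x)) :=
  tendsto_of_isProj hS (fun _ => isProj_proj x) (isProj_proj x)

end ProjectionHull

end ProjectionHulls

section ProjectionsToPlichko

open Filter Topology

namespace ProjectionHull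

variable {X : Type u} [NormedAddCommGroup X] [NormedSpace ℝ X] (G : ProjectionHull X)

/-! ### Long sequences of projections -/

section LongSequence

variable {ι : Type*} [LinearOrder ι] [WellFoundedLT ι] (e : ι → X ⊕ StrongDual ℝ X)

/-- An uncountable subset of a well-order is uncountable in a lower set all of whose proper initial
segments meet it in a countable set. -/
theorem exists_isLowerSet_not_countable {J : Set ι} (hJ : ¬ J.Countable) :
    ∃ I : Set ι, IsLowerSet I ∧ ¬ (J ∩ I).Countable ∧ ∀ i ∈ I, (J ∩ Set.Iic i).Countable := by
  have hIic : ∀ i, (J ∩ Set.Iio i).Countable → (J ∩ Set.Iic i).Countable := by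
    intro i hi
    refine (hi.union (Set.countable_singleton i)).mono ?_
    rintro j ⟨hj, hji⟩
    rcases lt_or_eq_of_le (Set.mem_Iic.1 hji) with h | h
    exacts [.inl ⟨hj, h⟩, .inr h]
  by_cases hall : ∀ i, (J ∩ Set.Iio i).Countable
  · exact ⟨Set.univ, isLowerSet_univ, by rwa [Set.inter_univ], fun i _ => hIic i (hall i)⟩
  · push Not at hall
    obtain ⟨i, hi, hmin⟩ := WellFounded.has_min (wellFounded_lt (α := ι))
      {i | ¬ (J ∩ Set.Iio i).Countable} hall
    refine ⟨Set.Iio i, isLowerSet_Iio i, hi, fun j hj => hIic j ?_⟩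
    by_contra h
    exact hmin j h hj

/-- A functional distinguishes only countably many pairs of consecutive projections. -/
theorem countable_setOf_apply_proj_ne (y : StrongDual ℝ X) :
    {i | ∃ x, y (G.proj (e '' Set.Iic i) x) ≠ y (G.proj (e '' Set.Iio i) x)}.Countable := by
  set J := {i | ∃ x, y (G.proj (e '' Set.Iic i) x) ≠ y (G.proj (e '' Set.Iio i) x)} with hJdef
  by_contra hJ
  obtain ⟨I, hI, hJI, hcount⟩ := exists_isLowerSet_not_countable hJ
  -- Otherwise `J ∩ I` would be a countable union of countable sets.
  have hbound : ∀ C : Set ι, C.Countable → C ⊆ I → ∃ j ∈ J ∩ I, ∀ i ∈ C, i < j := by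
    intro C hC hCI
    by_contra! hcon
    refine hJI ((hC.biUnion fun i hi => hcount i (hCI hi)).mono fun j hj => ?_)
    obtain ⟨i, hi, hji⟩ := hcon j hj
    exact Set.mem_biUnion hi ⟨hj.1, hji⟩
  obtain ⟨i₀, hi₀, -⟩ := hbound ∅ Set.countable_empty (Set.empty_subset _)
  have hne : Nonempty I := ⟨⟨i₀, hi₀.2⟩⟩
  have hIicI : ∀ i ∈ I, e '' Set.Iic i ⊆ e '' I := fun i hi =>
    Set.image_mono fun j hj => hI hj hi
  -- The net converges, and an index above the countably many thresholds for `1 / (n + 1)` makes it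
  -- constant from there on.
  have hstab : ∀ x, ∃ i : I, ∀ j : I, i ≤ j →
      G.proj (e '' Set.Iic j.1) x = G.proj (e '' I) x := by
    intro x
    have hmono : Monotone fun i : I => e '' Set.Iic i.1 := fun i j hij =>
      Set.image_mono (Set.Iic_subset_Iic.2 hij)
    have hU : ⋃ i : I, e '' Set.Iic i.1 = e '' I := by
      refine Set.Subset.antisymm (Set.iUnion_subset fun i => hIicI i.1 i.2) ?_
      rintro _ ⟨i, hi, rfl⟩
      exact Set.mem_iUnion.2 ⟨⟨i, hi⟩, i, Set.self_mem_Iic, rfl⟩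
    have hlim := G.tendsto_proj hmono x
    rw [hU, Metric.tendsto_nhds] at hlim
    choose f hf using fun n : ℕ => eventually_atTop.1 (hlim (1 / ((n : ℝ) + 1))
      Nat.one_div_pos_of_nat)
    obtain ⟨j, hj, hfj⟩ := hbound (Set.range fun n => (f n).1) (Set.countable_range _)
      (by rintro _ ⟨n, rfl⟩; exact (f n).2)
    refine ⟨⟨j, hj.2⟩, fun k hk => ?_⟩
    rw [← dist_le_zero]
    refine ge_of_tendsto' tendsto_one_div_add_atTop_nhds_zero_nat fun n => (hf n k ?_).le
    exact (show f n ≤ ⟨j, hj.2⟩ from (hfj _ ⟨n, rfl⟩).le).trans hk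
  choose g hg using hstab
  let T := {N : Set (X ⊕ StrongDual ℝ X) // N.Countable}
  have hnext : ∀ q : T × I, ∃ i : I, q.2 ≤ i ∧ ∀ x ∈ G.pts q.1.1, ∀ j : I, i ≤ j →
      G.proj (e '' Set.Iic j.1) x = G.proj (e '' I) x := by
    intro q
    have hpts : (G.pts q.1.1).Countable :=
      (G.countable _ q.1.2).preimage Sum.inl_injective
    obtain ⟨j, hj, hjC⟩ := hbound (insert q.2.1 ((fun x => (g x).1) '' G.pts q.1.1))
      ((hpts.image _).insert _) (by
        rintro _ (rfl | ⟨x, -, rfl⟩)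
        exacts [q.2.2, (g x).2])
    refine ⟨⟨j, hj.2⟩, (hjC _ (Set.mem_insert _ _)).le, fun x hx k hk => hg x k ?_⟩
    exact (show g x ≤ ⟨j, hj.2⟩ from (hjC _ (Set.mem_insert_of_mem _ ⟨x, hx, rfl⟩)).le).trans hk
  choose nx hnx1 hnx2 using hnext
  let y' : StrongDual ℝ X := y.comp (G.proj (e '' I))
  -- A closing-off argument: the next index lies beyond the stabilization of all points in the
  -- current hull, and `y` composed with the projection at that index joins the generators.
  let step : T × I → T × I := fun q =>
    (⟨insert (.inr (y.comp (G.proj (e '' Set.Iic (nx q).1)))) q.1.1, q.1.2.insert _⟩, nx q)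
  let st : ℕ → T × I := fun n => step^[n] (⟨{.inr y'}, Set.countable_singleton _⟩, ⟨i₀, hi₀.2⟩)
  have hst : ∀ n, st (n + 1) = step (st n) := fun n => Function.iterate_succ_apply' _ _ _
  have hNmono : Monotone fun n => (st n).1.1 :=
    monotone_nat_of_le_succ fun n => by rw [hst]; exact Set.subset_insert _ _
  have himono : Monotone fun n => (st n).2 :=
    monotone_nat_of_le_succ fun n => by rw [hst]; exact hnx1 _
  let D : Set (X ⊕ StrongDual ℝ X) := ⋃ n, e '' Set.Iic (st n).2.1
  have hDlim : ∀ x, Tendsto (fun n => G.proj (e '' Set.Iic (st n).2.1) x) atTop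
      (𝓝 (G.proj D x)) := fun x =>
    G.tendsto_proj (S := fun n => e '' Set.Iic (st n).2.1)
      (fun m n hmn => Set.image_mono (Set.Iic_subset_Iic.2 (himono hmn))) x
  have hDI : D ⊆ e '' I := Set.iUnion_subset fun n => hIicI _ (st n).2.2
  have hy'D : ∀ x, y' (G.proj D x) = y (G.proj D x) := fun x =>
    congrArg y (proj_proj_of_superset hDI x)
  let N : Set (X ⊕ StrongDual ℝ X) := ⋃ n, (st n).1.1
  have hspace : ∀ x ∈ G.space N, y' (G.proj D x) = y' x := by
    intro x hx
    rw [← SetLike.mem_coe, coe_space] at hx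
    refine closure_minimal (s := G.pts N) (t := {x | y' (G.proj D x) = y' x}) (fun x hx => ?_)
      (isClosed_eq (y'.continuous.comp (G.proj D).continuous) y'.continuous) hx
    obtain ⟨n, hn⟩ := exists_mem_pts_of_mem_pts_iUnion hNmono hx
    have h1 : G.proj D x = G.proj (e '' I) x := by
      refine tendsto_nhds_unique (hDlim x) (tendsto_const_nhds.congr' ?_)
      filter_upwards [eventually_ge_atTop (n + 1)] with m hm
      refine (hnx2 (st n) x hn _ ?_).symm
      have := himono hm
      simp only [hst] at this
      exact this
    show y' (G.proj D x) = y' x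
    rw [hy'D, h1]
    rfl
  have hker : ∀ z ∈ leftAnnihilator (G.fns N), y' (G.proj D z) = y' z := by
    intro z hz
    have hmem : ∀ n φ, .inr φ ∈ (st n).1.1 → φ z = 0 := fun n φ hφ =>
      hz φ (G.subset_hull _ (Set.mem_iUnion.2 ⟨n, hφ⟩))
    have h0 : y' z = 0 := hmem 0 y' rfl
    rw [hy'D, h0]
    refine tendsto_nhds_unique ((y.continuous.tendsto _).comp
      ((hDlim z).comp (tendsto_add_atTop_nat 1))) (tendsto_const_nhds.congr fun n => ?_)
    refine (hmem (n + 1) (y.comp (G.proj (e '' Set.Iic (st (n + 1)).2.1))) ?_).symm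
    simp only [hst]
    exact Set.mem_insert _ _
  -- Since `N` is countable by stages, its projection splits `x` into a part in `G.space N`, where
  -- the projections for `D` and `e '' I` agree, and a part on which `y'` and `y ∘ G.proj D` both
  -- vanish.
  have hy' : ∀ x, y' (G.proj D x) = y' x := by
    intro x
    have h1 := hspace _ (G.proj_mem (s := N) x)
    have h2 := hker _ (G.isProj_proj (s := N) x).2
    rw [map_sub, map_sub, map_sub, h1] at h2
    exact sub_left_inj.1 h2
  obtain ⟨j, ⟨⟨x, hx⟩, hjI⟩, hj⟩ := hbound (Set.range fun n => (st n).2.1)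
    (Set.countable_range _) (by rintro _ ⟨n, rfl⟩; exact (st n).2.2)
  -- Past all chosen indices `y` no longer sees the projection. Taking `K` to be `Set.Iic j` and
  -- `Set.Iio j` contradicts `j ∈ J`.
  have hconst : ∀ K : Set ι, Set.Iio j ⊆ K → K ⊆ I → y (G.proj (e '' K) x) = y' x := by
    intro K hjK hK
    have hDK : D ⊆ e '' K := Set.iUnion_subset fun n =>
      Set.image_mono fun i hi => hjK (lt_of_le_of_lt hi (hj _ ⟨n, rfl⟩))
    calc y (G.proj (e '' K) x) = y' (G.proj (e '' K) x) :=
          congrArg y (proj_proj_of_superset (Set.image_mono hK) x).symm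
      _ = y' (G.proj D (G.proj (e '' K) x)) := (hy' _).symm
      _ = y' x := by rw [proj_proj_of_subset hDK, hy']
  exact hx ((hconst _ Set.Iio_subset_Iic_self fun i hi => hI hi hjI).trans
    (hconst _ subset_rfl fun i hi => hI (le_of_lt hi) hjI).symm)

end LongSequence

/-! ### Construction of a Plichko set -/

/-- The space associated with `s` has a linearly dense subset on which every functional has
countable support. -/
def HasPlichkoSet (s : Set (X ⊕ StrongDual ℝ X)) : Prop :=
  ∃ A : Set X, A ⊆ G.space s ∧ G.space s ≤ (Submodule.span ℝ A).topologicalClosure ∧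
    ∀ y : StrongDual ℝ X, {a | a ∈ A ∧ y a ≠ 0}.Countable

variable {G}

theorem HasPlichkoSet.of_countable {s : Set (X ⊕ StrongDual ℝ X)} (hs : s.Countable) :
    G.HasPlichkoSet s := by
  refine ⟨G.pts s, fun x hx => pts_subset_space hx, ?_, fun y => ?_⟩
  · rw [space_le_iff (Submodule.isClosed_topologicalClosure _)]
    exact fun x hx => Submodule.le_topologicalClosure _ (Submodule.subset_span hx)
  · exact ((G.countable _ hs).preimage Sum.inl_injective).mono fun x hx => hx.1

/-- Take the images of the given sets under the differences `Q i` of consecutive projections. A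
functional is nonzero on the range of `Q i` for only countably many `i`, and for each of these only
countable support remains, as `y.comp (Q i)` is again a functional. -/
theorem HasPlichkoSet.range {ι : Type*} [LinearOrder ι] [WellFoundedLT ι]
    (e : ι → X ⊕ StrongDual ℝ X) (h : ∀ i, G.HasPlichkoSet (e '' Set.Iic i)) :
    G.HasPlichkoSet (Set.range e) := by
  -- The hull of the empty set may contain nonzero points, which no `Q i` accounts for.
  obtain ⟨A₀, hA₀, hspan₀, hcount₀⟩ := HasPlichkoSet.of_countable (G := G) Set.countable_empty
  choose A hA hspan hcount using h
  let Q : ι → X →L[ℝ] X := fun i => G.proj (e '' Set.Iic i) - G.proj (e '' Set.Iio i)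
  refine ⟨A₀ ∪ ⋃ i, Q i '' A i, ?_, ?_, fun y => ?_⟩
  · refine Set.union_subset (hA₀.trans (space_mono (Set.empty_subset _))) (Set.iUnion_subset ?_)
    rintro i _ ⟨a, -, rfl⟩
    exact sub_mem (space_mono (Set.image_subset_range _ _) (proj_mem a))
      (space_mono (Set.image_subset_range _ _) (proj_mem a))
  · set V := (Submodule.span ℝ (A₀ ∪ ⋃ i, Q i '' A i)).topologicalClosure
    have hVc : IsClosed (V : Set X) := Submodule.isClosed_topologicalClosure _
    have hV : ∀ a ∈ A₀ ∪ ⋃ i, Q i '' A i, a ∈ V := fun a ha =>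
      Submodule.le_topologicalClosure _ (Submodule.subset_span ha)
    have hle : ∀ B : Set X, (∀ a ∈ B, a ∈ V) → (Submodule.span ℝ B).topologicalClosure ≤ V :=
      fun B hB => Submodule.topologicalClosure_minimal _ (Submodule.span_le.2 hB) hVc
    have hlower : ∀ I : Set ι, IsLowerSet I → (∀ i ∈ I, G.space (e '' Set.Iic i) ≤ V) →
        G.space (e '' I) ≤ V := by
      intro I hI hIV
      rcases I.eq_empty_or_nonempty with rfl | hne
      · rw [Set.image_empty]
        exact hspan₀.trans (hle _ fun a ha => hV a (.inl ha))
      have : Nonempty I := hne.to_subtype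
      have hU : e '' I = ⋃ i : I, e '' Set.Iic i.1 := by
        refine Set.Subset.antisymm ?_
          (Set.iUnion_subset fun i => Set.image_mono fun j hj => hI hj i.2)
        rintro _ ⟨i, hi, rfl⟩
        exact Set.mem_iUnion.2 ⟨⟨i, hi⟩, i, Set.self_mem_Iic, rfl⟩
      rw [space_le_iff hVc, hU]
      intro x hx
      obtain ⟨i, hi⟩ := exists_mem_pts_of_mem_pts_iUnion (S := fun i : I => e '' Set.Iic i.1)
        (fun i j hij => Set.image_mono (Set.Iic_subset_Iic.2 hij)) hx
      exact hIV i.1 i.2 (pts_subset_space hi)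
    have hIic : ∀ i, G.space (e '' Set.Iic i) ≤ V := by
      intro i
      induction i using WellFoundedLT.induction with
      | ind i ih =>
        -- Transfinite induction: `a` is `Q i a` plus its projection to the space of the proper
        -- initial segment.
        refine (hspan i).trans (hle _ fun a ha => ?_)
        have h1 : G.proj (e '' Set.Iio i) a ∈ V := hlower _ (isLowerSet_Iio i) ih (proj_mem a)
        have h2 : Q i a ∈ V := hV _ (.inr (Set.mem_iUnion.2 ⟨i, a, ha, rfl⟩))
        have h3 : Q i a + G.proj (e '' Set.Iio i) a = a := by
          simp [Q, proj_of_mem (hA i ha)]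
        rw [← h3]
        exact add_mem h2 h1
    rw [← Set.image_univ]
    exact hlower _ isLowerSet_univ fun i _ => hIic i
  · refine ((hcount₀ y).union ((G.countable_setOf_apply_proj_ne e y).biUnion fun i _ =>
      ((hcount i (y.comp (Q i))).image (Q i)))).mono ?_
    rintro x ⟨hx | hx, hyx⟩
    · exact .inl ⟨hx, hyx⟩
    · obtain ⟨i, a, ha, rfl⟩ := Set.mem_iUnion.1 hx
      refine .inr (Set.mem_biUnion (x := i) ⟨a, fun heq => hyx ?_⟩ ⟨a, ⟨ha, hyx⟩, rfl⟩)
      simp [Q, heq]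

/-- Well-order an uncountable `s` in the type of its initial ordinal: every initial segment is then
smaller than `s`, and the induction hypothesis applies to it. -/
theorem hasPlichkoSet (G : ProjectionHull X) (s : Set (X ⊕ StrongDual ℝ X)) :
    G.HasPlichkoSet s := by
  induction hκ : Cardinal.mk s using WellFoundedLT.induction generalizing s with
  | ind κ ih =>
    by_cases hs : s.Countable
    · exact HasPlichkoSet.of_countable hs
    obtain ⟨_, _, hord⟩ := Cardinal.exists_ord_eq_type_lt s
    have hinf : Cardinal.aleph0 ≤ Cardinal.mk s := by
      rw [Cardinal.aleph0_le_mk_iff, Set.infinite_coe_iff]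
      exact fun hfin => hs hfin.countable
    have key := HasPlichkoSet.range (G := G) (fun i : s => i.1) fun i => by
      refine ih _ ?_ _ rfl
      rw [← hκ]
      refine Cardinal.mk_image_le.trans_lt ?_
      have h1 : Cardinal.mk (Set.Iio i) < Cardinal.mk s := Cardinal.mk_Iio_lt i hord
      rw [← Set.Iio_insert]
      exact Cardinal.mk_insert_le.trans_lt
        (Cardinal.add_lt_of_lt hinf h1 (Cardinal.one_lt_aleph0.trans_le hinf))
    rwa [Subtype.range_coe] at key

theorem exists_dense_span (G : ProjectionHull X) : ∃ A : Set X,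
    Dense (Submodule.span ℝ A : Set X) ∧
      ∀ y : StrongDual ℝ X, {a | a ∈ A ∧ y a ≠ 0}.Countable := by
  obtain ⟨A, -, hA, hcount⟩ := G.hasPlichkoSet Set.univ
  exact ⟨A, fun x => hA (pts_subset_space (G.subset_hull _ (Set.mem_univ _))), hcount⟩

end ProjectionHull

end ProjectionsToPlichko

section SkolemHulls

/-! ### Skolem hulls -/

/-- The closure in a structure is finitary. -/
theorem FirstOrder.Language.Substructure.exists_finite_mem_closure {L : Language} {H E : Type*}
    [L.Structure H] (f : E → H) (B : Set H) (s : Set E) {x : H}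
    (hx : x ∈ Substructure.closure L (f '' s ∪ B)) :
    ∃ t ⊆ s, t.Finite ∧ x ∈ Substructure.closure L (f '' t ∪ B) := by
  refine Substructure.closure_induction
    (p := fun x => ∃ t ⊆ s, t.Finite ∧ x ∈ Substructure.closure L (f '' t ∪ B)) hx ?_ ?_
  · rintro x (⟨e, he, rfl⟩ | hxB)
    · exact ⟨{e}, Set.singleton_subset_iff.2 he, Set.finite_singleton e,
        Substructure.subset_closure (.inl ⟨e, rfl, rfl⟩)⟩
    · exact ⟨∅, Set.empty_subset s, Set.finite_empty, Substructure.subset_closure (.inr hxB)⟩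
  · intro n g v hv
    choose t hts ht hvt using hv
    refine ⟨⋃ i, t i, Set.iUnion_subset hts, Set.finite_iUnion ht,
      Substructure.fun_mem _ g v fun i => ?_⟩
    exact Substructure.closure_mono
      (Set.union_subset_union_left B (Set.image_mono (Set.subset_iUnion t i))) (hvt i)

/-- Needed for Skolem hulls of countable sets to be countable. -/
instance countable_setLanguage_skolem :
    Countable (Σ n, (setLanguage.sum setLanguage.skolem₁).Functions n) := by
  rw [← Cardinal.mk_le_aleph0_iff]
  refine card_functions_sum_skolem₁_le.trans (max_le le_rfl ?_)
  have h1 : IsEmpty (Σ n, setLanguage.Functions n) := ⟨fun f => Empty.elim f.2⟩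
  have h2 : ∀ n, Countable (setLanguage.Relations n) := fun n =>
    (show Subsingleton (SetSymbol n) from ⟨fun a b => by cases a; cases b; rfl⟩).to_countable
  have h3 : Countable setLanguage.Symbols :=
    inferInstanceAs (Countable ((Σ n, setLanguage.Functions n) ⊕ (Σ n, setLanguage.Relations n)))
  exact Cardinal.mk_le_aleph0

namespace SetCopy

variable {X : Type u} [NormedAddCommGroup X] [NormedSpace ℝ X]
variable {c : SetCopy X} {θ : Cardinal.{u}}

namespace InHSet

variable (h : c.InHSet θ)

/-- The components of the space and its dual. -/
def base : Set (HSet θ) :=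
  {h.carrier, h.add, h.smul, h.norm, h.reals, h.realAdd, h.realMul, h.realLE, h.dual}

/-- The sets which represent points and functionals. -/
noncomputable def rep : X ⊕ StrongDual ℝ X → HSet θ := Sum.elim h.pt h.functional

theorem nonempty (h : c.InHSet θ) : Nonempty (HSet θ) := ⟨h.carrier⟩

/-- The Skolem hull of the components of the space, together with the given points and
functionals. -/
noncomputable def skolemHull (s : Set (X ⊕ StrongDual ℝ X)) :
    setLanguage.ElementarySubstructure (HSet θ) :=
  haveI := h.nonempty
  (Substructure.closure (setLanguage.sum setLanguage.skolem₁)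
    (h.rep '' s ∪ h.base)).elementarySkolem₁Reduct

theorem mem_skolemHull_of_mem {s : Set (X ⊕ StrongDual ℝ X)} {x : HSet θ}
    (hx : x ∈ h.rep '' s ∪ h.base) : x ∈ h.skolemHull s :=
  haveI := h.nonempty
  Substructure.subset_closure hx

theorem mem_skolemHull_self (s : Set (X ⊕ StrongDual ℝ X)) : h.Mem (h.skolemHull s) := by
  have hb : ∀ x ∈ h.base, x ∈ h.skolemHull s := fun x hx => h.mem_skolemHull_of_mem (.inr hx)
  constructor <;> exact hb _ (by simp [base])

theorem countable_skolemHull {s : Set (X ⊕ StrongDual ℝ X)} (hs : s.Countable) :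
    {x | x ∈ h.skolemHull s}.Countable := by
  have := h.nonempty
  have hb : h.base.Countable := by
    rw [base]
    exact (Set.toFinite _).countable
  have := ((hs.image h.rep).union hb).substructure_closure
    (setLanguage.sum setLanguage.skolem₁)
  exact Set.countable_coe_iff.1 this

/-- The hull operation given by elementary substructures of `H(θ)`, if `θ` is so large that the
dual of the space generates projections. -/
noncomputable def projectionHull
    (hdec : ∀ M : setLanguage.ElementarySubstructure (HSet θ), (elements M).Countable →
      c.components ⊆ elements M → c.functionals Set.univ ∈ elements M →
        c.Decomposes Set.univ (elements M)) : ProjectionHull X where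
  hull s := {e | h.rep e ∈ h.skolemHull s}
  subset_hull s e he := h.mem_skolemHull_of_mem (.inl ⟨e, he, rfl⟩)
  mono s t hst e he :=
    haveI := h.nonempty
    Substructure.closure_mono (Set.union_subset_union_left _ (Set.image_mono hst)) he
  finitary s e he := by
    have := h.nonempty
    exact Substructure.exists_finite_mem_closure h.rep h.base s he
  countable s hs := by
    have hC := h.countable_skolemHull hs
    refine ((hC.preimage (f := h.pt) fun x y hxy => c.pt.injective (HSet.ext_iff.1 hxy)).image
      Sum.inl |>.union ((hC.preimage (f := h.functional) fun φ ψ hφψ =>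
        c.functional_injective (HSet.ext_iff.1 hφψ)).image Sum.inr)).mono ?_
    rintro (x | φ) he
    · exact .inl ⟨x, he, rfl⟩
    · exact .inr ⟨φ, he, rfl⟩
  norming s _ x hx := (h.mem_skolemHull_self s).exists_norming hx
  decomposes s hs := by
    have hM := h.mem_skolemHull_self s
    obtain ⟨Y, hY, hc⟩ := hdec (h.skolemHull s)
      ((h.countable_skolemHull hs).image Subtype.val)
      (by
        rintro z (rfl | rfl | rfl | rfl | rfl | rfl | rfl | rfl)
        exacts [h.carrier_eq ▸ mem_elements.2 hM.carrier, h.add_eq ▸ mem_elements.2 hM.add,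
          h.smul_eq ▸ mem_elements.2 hM.smul, h.norm_eq ▸ mem_elements.2 hM.norm,
          h.reals_eq ▸ mem_elements.2 hM.reals, h.realAdd_eq ▸ mem_elements.2 hM.realAdd,
          h.realMul_eq ▸ mem_elements.2 hM.realMul,
          h.realLE_eq ▸ mem_elements.2 hM.realLE])
      (h.dual_eq ▸ mem_elements.2 hM.dual)
    have h1 : {x | c.pt x ∈ elements (h.skolemHull s)} = {x | h.rep (.inl x) ∈ h.skolemHull s} :=
      Set.ext fun x => mem_elements (x := h.pt x)
    have h2 : {φ | φ ∈ (Set.univ : Set (StrongDual ℝ X)) ∧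
        c.functional φ ∈ elements (h.skolemHull s)} =
        {φ | h.rep (.inr φ) ∈ h.skolemHull s} :=
      Set.ext fun φ => (and_iff_right trivial).trans (mem_elements (x := h.functional φ))
    rw [h1] at hY
    rw [h2] at hc
    exact ⟨Y, hY, hc⟩

end InHSet

theorem GeneratesProjections.isWLD {c : SetCopy X}
    (hgen : c.GeneratesProjections (Set.univ : Set (StrongDual ℝ X))) : IsWLD X := by
  obtain ⟨hn, θ₀, hθ₀⟩ := hgen
  obtain ⟨θ₁, hθ₁⟩ := c.exists_forall_nonempty_inHSet
  -- A single regular cardinal suffices; the successor of an infinite cardinal is regular.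
  let κ := max Cardinal.aleph0 (max θ₀ θ₁)
  have hκ : κ ≤ Order.succ κ := Order.le_succ κ
  obtain ⟨h⟩ := hθ₁ (Order.succ κ) (((le_max_right _ _).trans (le_max_right _ _)).trans hκ)
  obtain ⟨A, hA, hcount⟩ := (h.projectionHull (hθ₀ (Order.succ κ)
    (((le_max_left _ _).trans (le_max_right _ _)).trans hκ)
    (Cardinal.isRegular_succ (le_max_left _ _)))).exists_dense_span
  exact ⟨by simpa using hn, A, hA, fun y _ => hcount y⟩

end SetCopy

end SkolemHulls

theorem mainTheorem7 {X : Type*} [NormedAddCommGroup X] [NormedSpace ℝ X] [CompleteSpace X]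
    (c : SetCopy X) :
    c.GeneratesProjections (Set.univ : Set (StrongDual ℝ X)) ↔ IsWLD X :=
  ⟨SetCopy.GeneratesProjections.isWLD, c.generatesProjections_of_isWLD⟩
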